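/- Let $-\infty<a<b<\infty$ and let $p,q,r:(a,b)\to\mathbb R$ satisfy $p>0$ and $r>0$ a.e., and $1/p,\,q,\,r\in L^1((a,b);dx)$. Put $\tau g=\frac1r\big(-(pg')'+qg\big)$ and $g^{[1]}=pg'$. In the complex Hilbert space $L^2((a,b);r\,dx)$, with inner product $(\cdot,\cdot)$ linear in the second argument, let $H_{\max}f=\tau f$ on $$\operatorname{dom}(H_{\max})=\{g\in L^2((a,b);r\,dx)\;:\;g,\,g^{[1]}\in AC([a,b]),\ \tau g\in L^2((a,b);r\,dx)\}.$$ Let $H_{\min}$, $H_{0,0}$ and, for $F\in SL_2(\mathbb R)$ and $\phi\in\mathbb R$, $H_{F,\phi}$ be the restrictions of $H_{\max}$ by the boundary conditions $g(a)=g^{[1]}(a)=g(b)=g^{[1]}(b)=0$; $g(a)=g(b)=0$; and $(g(b),g^{[1]}(b))^\top=e^{i\phi}F\,(g(a),g^{[1]}(a))^\top$, respectively. The Krein–von Neumann extension $H_K$ of $H_{\min}$ is the restriction of $H_{\min}^*$ to $\operatorname{dom}(H_{\min})\dotplus\ker(H_{\min}^*)$. **(A)** Suppose that $H_{\min}$ is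 strictly positive: there is $\varepsilon>0$ with $(f,H_{\min}f)\ge\varepsilon\|f\|^2$ for all $f\in\operatorname{dom}(H_{\min})$. Then $H_{\min}$ is densely defined, the sum $\operatorname{dom}(H_{\min})+\ker(H_{\min}^*)$ is direct and is the domain of $H_K$, and $H_K$ is a self-adjoint extension of $H_{\min}$. Moreover $0\in\rho(H_{0,0})$, and for every $z\in\rho(H_{0,0})$ there are unique solutions $u_1(z,\cdot)$, $u_2(z,\cdot)$ of $\tau u=zu$ (with $u,u^{[1]}\in AC([a,b])$) such that $$u_1(z,a)=0,\quad u_1(z,b)=1,\quad u_2(z,a)=1,\quad u_2(z,b)=0.$$ The functions $u_j(0,\cdot)$ and $u_j^{[1]}(0,\cdot)$ are real-valued, and $u_1(0,\cdot),u_2(0,\cdot)$ form a basis of $\ker(H_{\min}^*)$, which therefore has dimension $2$. A function $g\in\operatorname{dom}(H_{\max})$ belongs to $\operatorname{dom}(H_K)$ if and only if $$g^{[1]}(a)=g(b)u_1^{[1]}(0,a)+g(a)u_2^{[1]}(0,a),\qquad g^{[1]}(b)=g(b)u_1^{[1]}(0,b)+g(a)u_2^{[1]}(0,b).$$ Furthermore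 $u_1^{[1]}(0,a)\ne0$, the matrix $$F_K=\frac1{u_1^{[1]}(0,a)}\begin{pmatrix}-u_2^{[1]}(0,a)&1\\ u_1^{[1]}(0,a)u_2^{[1]}(0,b)-u_1^{[1]}(0,b)u_2^{[1]}(0,a)&u_1^{[1]}(0,b)\end{pmatrix}$$ belongs to $SL_2(\mathbb R)$, and $H_K=H_{F_K,0}$; that is, $H_K$ is the restriction of $H_{\max}$ by the boundary condition $(u(b),u^{[1]}(b))^\top=F_K\,(u(a),u^{[1]}(a))^\top$. For $F\in SL_2(\mathbb R)$ with $F_{1,2}\neq0$ put $$Q_{F,\phi}(z)=\begin{pmatrix}\frac{F_{2,2}}{F_{1,2}}-u_1^{[1]}(z,b)&\frac{-1}{e^{-i\phi}F_{1,2}}-u_2^{[1]}(z,b)\\ \frac{-1}{e^{i\phi}F_{1,2}}+u_1^{[1]}(z,a)&\frac{F_{1,1}}{F_{1,2}}+u_2^{[1]}(z,a)\end{pmatrix}.$$ Then, for every $z\in\rho(H_K)\cap\rho(H_{0,0})$, $$Q_{F_K,0}(z)=\begin{pmatrix}u_1^{[1]}(0,b)-u_1^{[1]}(z,b)&-u_1^{[1]}(0,a)-u_2^{[1]}(z,b)\\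 -u_1^{[1]}(0,a)+u_1^{[1]}(z,a)&-u_2^{[1]}(0,a)+u_2^{[1]}(z,a)\end{pmatrix}$$ is invertible and $$(H_K-z)^{-1}=(H_{0,0}-z)^{-1}-\sum_{j,k=1}^2\big(Q_{F_K,0}(z)^{-1}\big)_{j,k}\,(u_k(\overline z,\cdot),\,\cdot\,)\,u_j(z,\cdot).$$ **(B)** Suppose that $q=0$ a.e. on $(a,b)$. Then $H_{\min}$ is strictly positive. Put $P(x)=\int_a^x p(t)^{-1}\,dt$. The solutions of (A) at $z=0$ are $$u_1(0,x)=\frac{P(x)}{P(b)},\qquad u_2(0,x)=1-\frac{P(x)}{P(b)},\qquad u_1^{[1]}(0,x)=\frac1{P(b)}=-u_2^{[1]}(0,x),\qquad x\in[a,b].$$ They form a basis of $\ker(H_{\min}^*)$ and satisfy $H_{\min}^*u_j(0,\cdot)=H_{\max}u_j(0,\cdot)=0$. The matrix $F_K$ is $F_K^{(0)}=\begin{pmatrix}1&P(b)\\0&1\end{pmatrix}$, and $H_K=H_{F_K^{(0)},0}$. A function $u\in\operatorname{dom}(H_{\max})$ belongs to $\operatorname{dom}(H_K)$ if and only if $$u^{[1]}(b)=u^{[1]}(a)=\frac{u(b)-u(a)}{P(b)}.$$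 -/

import Mathlib

open MeasureTheory Set
open scoped ComplexConjugate

noncomputable section

/-! ## Unbounded operators in a Hilbert space -/

section Operators

variable {H : Type*} [NormedAddCommGroup H] [InnerProductSpace ℂ H]

/-- The kernel of an unbounded operator, as a subspace of the Hilbert space. -/
def operatorKer (A : H →ₗ.[ℂ] H) : Submodule ℂ H :=
  (LinearMap.ker A.toFun).map A.domain.subtype

/-- `A` is strictly positive: `(f, A f) ≥ ε ‖f‖²` on the domain, for some `ε > 0`. -/
def StrictlyPositive (A : H →ₗ.[ℂ] H) : Prop :=
  ∃ ε : ℝ, 0 < ε ∧ ∀ f : A.domain, ε * ‖(f : H)‖ ^ 2 ≤ (inner ℂ (f : H) (A f)).re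

/-- `R` is the bounded inverse of `A - z`, i.e. `R = (A - z)⁻¹`. -/
def IsResolventAt (A : H →ₗ.[ℂ] H) (z : ℂ) (R : H →L[ℂ] H) : Prop :=
  (∀ f : H, ∃ h : R f ∈ A.domain, A ⟨R f, h⟩ - z • R f = f) ∧
    ∀ g : A.domain, R (A g - z • (g : H)) = g

/-- The resolvent set `ρ(A)`. -/
def resolventSetOf (A : H →ₗ.[ℂ] H) : Set ℂ :=
  {z | ∃ R : H →L[ℂ] H, IsResolventAt A z R}

/-- The Krein-von Neumann extension of `A`: the restriction of `A†` to `dom A + ker A†`. -/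
def kreinVonNeumann [CompleteSpace H] (A : H →ₗ.[ℂ] H) : H →ₗ.[ℂ] H :=
  A.adjoint.domRestrict (A.domain ⊔ operatorKer A.adjoint)

end Operators

/-! ## Absolutely continuous functions with complex values -/

lemma AbsolutelyContinuousOnInterval.ae_differentiableAt_complex {f : ℝ → ℂ} {a b : ℝ}
    (hab : a ≤ b) (hf : AbsolutelyContinuousOnInterval f a b) :
    ∀ᵐ x ∂(volume.restrict (Ioo a b)), DifferentiableAt ℝ f x := by
  rw [ae_restrict_iff' measurableSet_Ioo]
  filter_upwards [hf.boundedVariationOn.ae_differentiableAt_of_mem_uIcc] with x hx hx'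
  exact hx (by rw [uIcc_of_le hab]; exact Ioo_subset_Icc_self hx')

/-! ## Regular Sturm-Liouville operators -/

/-- The coefficients of a regular Sturm-Liouville expression
`τ = r⁻¹ (-(d/dx) p (d/dx) + q)` on a finite interval `(a, b)`: `p, r > 0` almost everywhere,
and `1/p, q, r` are integrable. -/
structure SturmLiouville where
  a : ℝ
  b : ℝ
  hab : a < b
  p : ℝ → ℝ
  q : ℝ → ℝ
  r : ℝ → ℝ
  p_pos : ∀ᵐ x ∂(volume.restrict (Ioo a b)), 0 < p x
  r_pos : ∀ᵐ x ∂(volume.restrict (Ioo a b)), 0 < r x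
  p_inv_integrable : IntegrableOn (fun x => 1 / p x) (Ioo a b)
  q_integrable : IntegrableOn q (Ioo a b)
  r_integrable : IntegrableOn r (Ioo a b)

namespace SturmLiouville

variable (S : SturmLiouville)

/-- The measure `r dx` on `(a, b)`. -/
def weight : Measure ℝ :=
  (volume.restrict (Ioo S.a S.b)).withDensity (fun x => ENNReal.ofReal (S.r x))

/-- The Hilbert space `L²((a, b); r dx)`. -/
abbrev L2 : Type := Lp ℂ 2 S.weight

/-- `g` and its quasi-derivative `v = g^{[1]} = p g'` are absolutely continuous on `[a, b]`. The
almost everywhere equality determines the absolutely continuous function `v` on `[a, b]`, in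
particular the values `v a` and `v b`. -/
structure IsQuasiPair (g v : ℝ → ℂ) : Prop where
  ac : AbsolutelyContinuousOnInterval g S.a S.b
  ac_quasi : AbsolutelyContinuousOnInterval v S.a S.b
  quasi_eq : ∀ᵐ x ∂(volume.restrict (Ioo S.a S.b)), v x = (S.p x : ℂ) * deriv g x

/-- `τ g = r⁻¹ (-(g^{[1]})' + q g)`, where `v` is the quasi-derivative of `g`. -/
def tau (g v : ℝ → ℂ) (x : ℝ) : ℂ :=
  (1 / (S.r x : ℂ)) * (-deriv v x + (S.q x : ℂ) * g x)

/-- The space of boundary data `((g(a), g^{[1]}(a)), (g(b), g^{[1]}(b)))`. -/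
abbrev BoundaryData : Type := (Fin 2 → ℂ) × (Fin 2 → ℂ)

/-- The boundary data of `g`, where `v` is the quasi-derivative of `g`. -/
def boundaryData (g v : ℝ → ℂ) : BoundaryData :=
  (![g S.a, v S.a], ![g S.b, v S.b])

/-- `(g, v)` represents the element `(f, h)` of the graph of the maximal operator: `g` represents
`f`, `g` and `v = g^{[1]}` are absolutely continuous on `[a, b]`, and `τ g` represents the element
`h` of `L²((a, b); r dx)`. -/
structure Represents (g v : ℝ → ℂ) (f h : S.L2) : Prop where
  pair : S.IsQuasiPair g v
  fst_eq : (f : ℝ → ℂ) =ᵐ[S.weight] g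
  snd_eq : (h : ℝ → ℂ) =ᵐ[S.weight] S.tau g v

lemma ae_weight {P : ℝ → Prop} (h : ∀ᵐ x ∂(volume.restrict (Ioo S.a S.b)), P x) :
    ∀ᵐ x ∂S.weight, P x :=
  (withDensity_absolutelyContinuous _ _).ae_le h

lemma ae_of_ae_weight {P : ℝ → Prop} (h : ∀ᵐ x ∂S.weight, P x) :
    ∀ᵐ x ∂(volume.restrict (Ioo S.a S.b)), P x := by
  have hm : AEMeasurable (fun x => ENNReal.ofReal (S.r x)) (volume.restrict (Ioo S.a S.b)) :=
    S.r_integrable.aemeasurable.ennreal_ofReal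
  refine (withDensity_absolutelyContinuous' hm ?_).ae_le h
  filter_upwards [S.r_pos] with x hx
  simpa using hx

variable {S}

lemma Represents.add {g₁ v₁ g₂ v₂ : ℝ → ℂ} {f₁ h₁ f₂ h₂ : S.L2}
    (H₁ : S.Represents g₁ v₁ f₁ h₁) (H₂ : S.Represents g₂ v₂ f₂ h₂) :
    S.Represents (g₁ + g₂) (v₁ + v₂) (f₁ + f₂) (h₁ + h₂) := by
  refine ⟨⟨H₁.pair.ac.add H₂.pair.ac, H₁.pair.ac_quasi.add H₂.pair.ac_quasi, ?_⟩, ?_, ?_⟩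
  · filter_upwards [H₁.pair.quasi_eq, H₂.pair.quasi_eq,
      H₁.pair.ac.ae_differentiableAt_complex S.hab.le,
      H₂.pair.ac.ae_differentiableAt_complex S.hab.le] with x e₁ e₂ d₁ d₂
    rw [Pi.add_apply, e₁, e₂, deriv_add d₁ d₂, mul_add]
  · exact (Lp.coeFn_add f₁ f₂).trans (H₁.fst_eq.add H₂.fst_eq)
  · filter_upwards [Lp.coeFn_add h₁ h₂, H₁.snd_eq, H₂.snd_eq,
      S.ae_weight (H₁.pair.ac_quasi.ae_differentiableAt_complex S.hab.le),
      S.ae_weight (H₂.pair.ac_quasi.ae_differentiableAt_complex S.hab.le)] with x e e₁ e₂ d₁ d₂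
    rw [e, Pi.add_apply, e₁, e₂, tau, tau, tau, deriv_add d₁ d₂, Pi.add_apply]
    ring

lemma Represents.smul {g v : ℝ → ℂ} {f h : S.L2} (c : ℂ) (H : S.Represents g v f h) :
    S.Represents (c • g) (c • v) (c • f) (c • h) := by
  refine ⟨⟨H.pair.ac.const_smul c, H.pair.ac_quasi.const_smul c, ?_⟩, ?_, ?_⟩
  · filter_upwards [H.pair.quasi_eq, H.pair.ac.ae_differentiableAt_complex S.hab.le] with x e d
    rw [Pi.smul_apply, e, deriv_const_smul c d, smul_eq_mul, smul_eq_mul]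
    ring
  · exact (Lp.coeFn_smul c f).trans (H.fst_eq.const_smul c)
  · filter_upwards [Lp.coeFn_smul c h, H.snd_eq,
      S.ae_weight (H.pair.ac_quasi.ae_differentiableAt_complex S.hab.le)] with x e e₁ d
    rw [e, Pi.smul_apply, e₁, tau, tau, deriv_const_smul c d, Pi.smul_apply, smul_eq_mul,
      smul_eq_mul, smul_eq_mul]
    ring

lemma Represents.zero : S.Represents 0 0 0 0 := by
  have h0 : AbsolutelyContinuousOnInterval (0 : ℝ → ℂ) S.a S.b :=
    (LipschitzWith.const (0 : ℂ)).lipschitzOnWith.absolutelyContinuousOnInterval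
  refine ⟨⟨h0, h0, by simp⟩, Lp.coeFn_zero _ _ _, ?_⟩
  filter_upwards [Lp.coeFn_zero ℂ 2 S.weight] with x hx
  rw [hx]
  simp [tau]

lemma boundaryData_add (g₁ v₁ g₂ v₂ : ℝ → ℂ) :
    S.boundaryData (g₁ + g₂) (v₁ + v₂) = S.boundaryData g₁ v₁ + S.boundaryData g₂ v₂ := by
  simp [boundaryData]

lemma boundaryData_smul (c : ℂ) (g v : ℝ → ℂ) :
    S.boundaryData (c • g) (c • v) = c • S.boundaryData g v := by
  simp [boundaryData]

lemma boundaryData_zero : S.boundaryData 0 0 = 0 := by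
  ext i <;> fin_cases i <;> simp [boundaryData]

variable (S)

/-- The graph of the restriction of the maximal operator to those functions whose boundary data
lie in the subspace `M`. -/
def graphWith (M : Submodule ℂ BoundaryData) : Submodule ℂ (S.L2 × S.L2) where
  carrier := {w | ∃ g v, S.Represents g v w.1 w.2 ∧ S.boundaryData g v ∈ M}
  zero_mem' := ⟨0, 0, Represents.zero, by rw [boundaryData_zero]; exact M.zero_mem⟩
  add_mem' := by
    rintro _ _ ⟨g₁, v₁, H₁, m₁⟩ ⟨g₂, v₂, H₂, m₂⟩
    exact ⟨_, _, H₁.add H₂, by rw [boundaryData_add]; exact M.add_mem m₁ m₂⟩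
  smul_mem' := by
    rintro c _ ⟨g, v, H, m⟩
    exact ⟨_, _, H.smul c, by rw [boundaryData_smul]; exact M.smul_mem c m⟩

/-- The restriction of the maximal operator, `f ↦ τ f`, to those functions whose boundary data
lie in the subspace `M`. -/
def operatorWith (M : Submodule ℂ BoundaryData) : S.L2 →ₗ.[ℂ] S.L2 :=
  (S.graphWith M).toLinearPMap

variable {S}

lemma graphWith_functional (M : Submodule ℂ BoundaryData) (w : S.L2 × S.L2)
    (hw : w ∈ S.graphWith M) (h0 : w.1 = 0) : w.2 = 0 := by
  obtain ⟨g, v, H, -⟩ := hw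
  have hcg : ContinuousOn g (Ioo S.a S.b) := H.pair.ac.continuousOn.mono (by
    rw [uIcc_of_le S.hab.le]; exact Ioo_subset_Icc_self)
  have hcv : ContinuousOn v (Ioo S.a S.b) := H.pair.ac_quasi.continuousOn.mono (by
    rw [uIcc_of_le S.hab.le]; exact Ioo_subset_Icc_self)
  have hg0 : EqOn g 0 (Ioo S.a S.b) := by
    refine Measure.eqOn_Ioo_of_ae_eq (μ := volume) ?_ hcg continuousOn_const
    refine S.ae_of_ae_weight ?_
    have h1 := H.fst_eq
    rw [h0] at h1
    filter_upwards [h1, Lp.coeFn_zero ℂ 2 S.weight] with x e₁ e₂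
    rw [← e₁, e₂]
  have hd : ∀ u : ℝ → ℂ, EqOn u 0 (Ioo S.a S.b) → ∀ x ∈ Ioo S.a S.b, deriv u x = 0 := by
    intro u hu x hx
    have : u =ᶠ[nhds x] fun _ => (0 : ℂ) := by
      filter_upwards [Ioo_mem_nhds hx.1 hx.2] with y hy using hu hy
    rw [this.deriv_eq, deriv_const]
  have hv0 : EqOn v 0 (Ioo S.a S.b) := by
    refine Measure.eqOn_Ioo_of_ae_eq (μ := volume) ?_ hcv continuousOn_const
    filter_upwards [H.pair.quasi_eq, ae_restrict_mem measurableSet_Ioo] with x e hx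
    rw [e, hd g hg0 x hx, mul_zero, Pi.zero_apply]
  rw [Lp.eq_zero_iff_ae_eq_zero]
  filter_upwards [H.snd_eq, S.ae_weight (ae_restrict_mem measurableSet_Ioo)] with x e hx
  rw [e, tau, hd v hv0 x hx, hg0 hx]
  simp

/-- The operator `operatorWith M` has the graph `graphWith M`. -/
lemma operatorWith_graph (M : Submodule ℂ BoundaryData) :
    (S.operatorWith M).graph = S.graphWith M :=
  Submodule.toLinearPMap_graph_eq _ (graphWith_functional M)

variable (S)

/-- The maximal operator. -/
def Hmax : S.L2 →ₗ.[ℂ] S.L2 := S.operatorWith ⊤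

/-- The minimal operator: `g(a) = g^{[1]}(a) = g(b) = g^{[1]}(b) = 0`. -/
def Hmin : S.L2 →ₗ.[ℂ] S.L2 := S.operatorWith ⊥

/-- The Dirichlet boundary conditions `g(a) = g(b) = 0`. -/
def dirichletData : Submodule ℂ BoundaryData where
  carrier := {w | w.1 0 = 0 ∧ w.2 0 = 0}
  zero_mem' := by simp
  add_mem' := by
    rintro x y ⟨h₁, h₂⟩ ⟨h₃, h₄⟩
    simp [h₁, h₂, h₃, h₄]
  smul_mem' := by
    rintro c x ⟨h₁, h₂⟩
    simp [h₁, h₂]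

/-- The Dirichlet operator `H_{0,0}`. -/
def HDirichlet : S.L2 →ₗ.[ℂ] S.L2 := S.operatorWith dirichletData

/-- The boundary condition `(g(b), g^{[1]}(b))ᵀ = e^{iφ} F (g(a), g^{[1]}(a))ᵀ`. -/
def coupledData (F : Matrix.SpecialLinearGroup (Fin 2) ℝ) (φ : ℝ) :
    Submodule ℂ BoundaryData where
  carrier := {w | w.2 = Complex.exp (Complex.I * φ) •
    Matrix.mulVec (F.1.map (fun t : ℝ => (t : ℂ))) w.1}
  zero_mem' := by
    simp only [mem_ofPred_eq]
    rw [Prod.fst_zero, Prod.snd_zero, Matrix.mulVec_zero, smul_zero]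
  add_mem' := by
    intro x y hx hy
    simp only [mem_ofPred_eq] at hx hy ⊢
    rw [Prod.snd_add, Prod.fst_add, hx, hy, Matrix.mulVec_add, smul_add]
  smul_mem' := by
    intro c x hx
    simp only [mem_ofPred_eq] at hx ⊢
    rw [Prod.smul_snd, Prod.smul_fst, hx, Matrix.mulVec_smul, smul_comm]

/-- The operator `H_{F,φ}` with coupled boundary conditions. -/
def HCoupled (F : Matrix.SpecialLinearGroup (Fin 2) ℝ) (φ : ℝ) : S.L2 →ₗ.[ℂ] S.L2 :=
  S.operatorWith (coupledData F φ)

/-- The Krein-von Neumann extension of the minimal operator. -/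
def HKrein : S.L2 →ₗ.[ℂ] S.L2 := kreinVonNeumann S.Hmin

/-- `u` solves `τ u = z u`, and `v` is its quasi-derivative. -/
def IsSolution (z : ℂ) (u v : ℝ → ℂ) : Prop :=
  S.IsQuasiPair u v ∧
    ∀ᵐ x ∂(volume.restrict (Ioo S.a S.b)), S.tau u v x = z * u x

/-- `u 0, u 1` are the solutions `u₁(z, ·), u₂(z, ·)` of `τ u = z u` with
`u₁(z, a) = 0`, `u₁(z, b) = 1`, `u₂(z, a) = 1`, `u₂(z, b) = 0`;
`v 0, v 1` are their quasi-derivatives. -/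
structure IsBoundaryBasis (z : ℂ) (u v : Fin 2 → ℝ → ℂ) : Prop where
  sol : ∀ j, S.IsSolution z (u j) (v j)
  fst_a : u 0 S.a = 0
  fst_b : u 0 S.b = 1
  snd_a : u 1 S.a = 1
  snd_b : u 1 S.b = 0

/-- The matrix `F_K` formed from the quasi-derivatives `v 0, v 1` of `u₁(0, ·), u₂(0, ·)`. -/
def kreinMatrix (v : Fin 2 → ℝ → ℂ) : Matrix (Fin 2) (Fin 2) ℂ :=
  (1 / v 0 S.a) • !![-v 1 S.a, 1;
    v 0 S.a * v 1 S.b - v 0 S.b * v 1 S.a, v 0 S.b]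

/-- The matrix `Q_{F,φ}(z)` (for `F₁₂ ≠ 0`) formed from the quasi-derivatives `v 0, v 1` of
`u₁(z, ·), u₂(z, ·)`. -/
def resolventMatrix (F : Matrix.SpecialLinearGroup (Fin 2) ℝ) (φ : ℝ) (v : Fin 2 → ℝ → ℂ) :
    Matrix (Fin 2) (Fin 2) ℂ :=
  !![(F.1 1 1 : ℂ) / F.1 0 1 - v 0 S.b,
      -1 / (Complex.exp (-(Complex.I * φ)) * F.1 0 1) - v 1 S.b;
    -1 / (Complex.exp (Complex.I * φ) * F.1 0 1) + v 0 S.a,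
      (F.1 0 0 : ℂ) / F.1 0 1 + v 1 S.a]

/-- `x ↦ ∫_a^x p(t)⁻¹ dt`. -/
def pInt (x : ℝ) : ℝ := ∫ t in S.a..x, 1 / S.p t

/-- The functions `u₁⁽⁰⁾(0, ·)` and `u₂⁽⁰⁾(0, ·)` of the case `q = 0`. -/
def freeSol : Fin 2 → ℝ → ℂ :=
  ![fun x => (((S.pInt S.b)⁻¹ * S.pInt x : ℝ) : ℂ),
    fun x => ((1 - (S.pInt S.b)⁻¹ * S.pInt x : ℝ) : ℂ)]

/-- The (constant) quasi-derivatives of the functions `freeSol`. -/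
def freeQuasi : Fin 2 → ℝ → ℂ :=
  ![fun _ => (((S.pInt S.b)⁻¹ : ℝ) : ℂ), fun _ => ((-(S.pInt S.b)⁻¹ : ℝ) : ℂ)]

/-- The matrix `F_K⁽⁰⁾` of the case `q = 0`. -/
def freeKreinMatrix : Matrix.SpecialLinearGroup (Fin 2) ℝ :=
  ⟨!![1, S.pInt S.b; 0, 1], by simp [Matrix.det_fin_two]⟩

end SturmLiouville

end

noncomputable section

/-! ## Absolutely continuous primitives -/

/-! The equation `τ g = h` is the first-order system `g' = v / p`, `v' = q g - r h` with integrable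
coefficients, handled in integrated form (`SolvesWith`). Picard iteration solves it for given data
at `a`, and Lagrange's identity gives Green's formula (`inner_sub_inner`), constant Wronskians and
Duhamel's formula. Every operator is treated through its graph, whose elements carry well-defined
boundary data.

At `z = 0`, Duhamel's formula shows that every `h` orthogonal to the fundamental solutions `c`, `s`
is in the range of `Hmin`. As their span is finite-dimensional, double orthogonality turns a
formally adjoint pair into an element of the graph of `Hmax` (`mem_graph_Hmax_of_formalAdjoint`).
Density of the domain and `Hmin.adjoint = Hmax` follow.

Solvability of the Dirichlet problem at `z` is governed by `s(b) ≠ 0`. If `s(b) = 0` at `z = 0`,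
then `s` would be a limit of elements `f` of the domain of `Hmin` with `(f, Hmin f) → 0`
(`exists_form_approximation`), which strict positivity forbids.

Once `s(b) ≠ 0`, subtracting `g(b) u₁ + g(a) u₂` from `g` leaves a function vanishing at both ends,
and it lies in the domain of `Hmin` exactly when its quasi-derivatives vanish there too. This is the
Krein condition (`mem_HKrein_domain_iff`). The Wronskian relation `u₂^{[1]}(b) = -u₁^{[1]}(a)` makes
the condition self-adjoint and gives `det F_K = 1`. For the resolvent, the Dirichlet resolvent is
corrected by a combination of `u₁(z, ·)`, `u₂(z, ·)`; the Krein condition is then a linear system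
with matrix `Q`. When `q = 0`, an energy estimate gives strict positivity and the solutions are
explicit. -/

lemma AbsolutelyContinuousOnInterval.of_dist_le {X Y : Type*} [PseudoMetricSpace X]
    [PseudoMetricSpace Y] {f : ℝ → X} {g : ℝ → Y} {a b : ℝ}
    (hf : AbsolutelyContinuousOnInterval f a b) (h : ∀ x y, dist (g x) (g y) ≤ dist (f x) (f y)) :
    AbsolutelyContinuousOnInterval g a b :=
  squeeze_zero (fun _ => Finset.sum_nonneg fun _ _ => dist_nonneg)
    (fun _ => Finset.sum_le_sum fun _ _ => h _ _) hf

lemma AbsolutelyContinuousOnInterval.re {f : ℝ → ℂ} {a b : ℝ}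
    (hf : AbsolutelyContinuousOnInterval f a b) :
    AbsolutelyContinuousOnInterval (fun x => (f x).re) a b :=
  hf.of_dist_le fun x y => by
    rw [Real.dist_eq, dist_eq_norm, ← Complex.sub_re]; exact Complex.abs_re_le_norm _

lemma AbsolutelyContinuousOnInterval.im {f : ℝ → ℂ} {a b : ℝ}
    (hf : AbsolutelyContinuousOnInterval f a b) :
    AbsolutelyContinuousOnInterval (fun x => (f x).im) a b :=
  hf.of_dist_le fun x y => by
    rw [Real.dist_eq, dist_eq_norm, ← Complex.sub_im]; exact Complex.abs_im_le_norm _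

lemma AbsolutelyContinuousOnInterval.of_re_im {f : ℝ → ℂ} {a b : ℝ}
    (hr : AbsolutelyContinuousOnInterval (fun x => (f x).re) a b)
    (hi : AbsolutelyContinuousOnInterval (fun x => (f x).im) a b) :
    AbsolutelyContinuousOnInterval f a b := by
  have h1 : AbsolutelyContinuousOnInterval (fun x => ((f x).re : ℂ)) a b :=
    hr.of_dist_le fun x y => (Complex.isometry_ofReal.dist_eq _ _).le
  have h2 : AbsolutelyContinuousOnInterval (fun x => ((f x).im : ℂ)) a b :=
    hi.of_dist_le fun x y => (Complex.isometry_ofReal.dist_eq _ _).le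
  have h3 := h1.add (h2.const_smul Complex.I)
  have e : f = (fun x => ((f x).re : ℂ)) + fun x => Complex.I • ((f x).im : ℂ) := by
    funext x
    rw [Pi.add_apply, smul_eq_mul, mul_comm Complex.I, Complex.re_add_im]
  rwa [e]

/-- `F` is absolutely continuous on `[a, b]` with (almost everywhere) derivative `f`. -/
structure IsPrimitiveOn (F f : ℝ → ℂ) (a b : ℝ) : Prop where
  integrable : IntervalIntegrable f volume a b
  eq_add : ∀ x ∈ Icc a b, F x = F a + ∫ t in a..x, f t

namespace IsPrimitiveOn

variable {F G f g : ℝ → ℂ} {a b : ℝ}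

lemma integrable_to (h : IsPrimitiveOn F f a b) {x : ℝ} (hx : x ∈ Icc a b) :
    IntervalIntegrable f volume a x := by
  refine h.integrable.mono_set ?_
  rw [uIcc_of_le hx.1, uIcc_of_le (hx.1.trans hx.2)]
  exact Icc_subset_Icc_right hx.2

lemma integral_eq (hab : a ≤ b) (h : IsPrimitiveOn F f a b) : ∫ t in a..b, f t = F b - F a := by
  rw [h.eq_add b ⟨hab, le_rfl⟩]; ring

lemma ac (hab : a ≤ b) (h : IsPrimitiveOn F f a b) : AbsolutelyContinuousOnInterval F a b := by
  have key : AbsolutelyContinuousOnInterval (fun x => ∫ t in a..x, f t) a b := by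
    have hre := (intervalIntegrable_iff.2 (intervalIntegrable_iff.1 h.integrable).re)
    have him := (intervalIntegrable_iff.2 (intervalIntegrable_iff.1 h.integrable).im)
    have ht : ∀ {φ : ℝ → ℝ} {ψ : ℝ → ℝ}, AbsolutelyContinuousOnInterval φ a b →
        EqOn ψ φ (uIcc a b) → AbsolutelyContinuousOnInterval ψ a b := by
      intro φ ψ h1 h2
      rw [absolutelyContinuousOnInterval_iff] at h1 ⊢
      intro ε hε
      obtain ⟨δ, hδ, H⟩ := h1 ε hε
      refine ⟨δ, hδ, fun E hE hs => ?_⟩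
      convert H E hE hs using 2 with i hi
      have := hE.1 i hi
      rw [h2 this.1, h2 this.2]
    refine .of_re_im
      (ht (hre.absolutelyContinuousOnInterval_intervalIntegral (c := a) left_mem_uIcc) ?_)
      (ht (him.absolutelyContinuousOnInterval_intervalIntegral (c := a) left_mem_uIcc) ?_)
    · intro x hx
      rw [uIcc_of_le hab] at hx
      exact (Complex.reCLM.intervalIntegral_comp_comm (h.integrable_to hx)).symm
    · intro x hx
      rw [uIcc_of_le hab] at hx
      exact (Complex.imCLM.intervalIntegral_comp_comm (h.integrable_to hx)).symm
  have hc : AbsolutelyContinuousOnInterval (fun _ : ℝ => F a) a b :=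
    (LipschitzWith.const (F a)).lipschitzOnWith.absolutelyContinuousOnInterval
  have h1 := hc.add key
  rw [absolutelyContinuousOnInterval_iff] at h1 ⊢
  intro ε hε
  obtain ⟨δ, hδ, H⟩ := h1 ε hε
  refine ⟨δ, hδ, fun E hE hs => ?_⟩
  convert H E hE hs using 2 with i hi
  have := hE.1 i hi
  rw [uIcc_of_le hab] at this
  rw [h.eq_add _ this.1, h.eq_add _ this.2]; rfl

lemma continuousOn (hab : a ≤ b) (h : IsPrimitiveOn F f a b) : ContinuousOn F (Icc a b) := by
  have := (h.ac hab).continuousOn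
  rwa [uIcc_of_le hab] at this

lemma ae_hasDerivAt (hab : a ≤ b) (h : IsPrimitiveOn F f a b) :
    ∀ᵐ x ∂(volume.restrict (Ioo a b)), HasDerivAt F (f x) x := by
  rw [ae_restrict_iff' measurableSet_Ioo]
  filter_upwards [h.integrable.ae_hasDerivAt_integral] with x hx hx'
  have hd := (hx (by rw [uIcc_of_le hab]; exact Ioo_subset_Icc_self hx') a
    left_mem_uIcc).const_add (F a)
  refine hd.congr_of_eventuallyEq ?_
  filter_upwards [Ioo_mem_nhds hx'.1 hx'.2] with y hy
  exact h.eq_add y (Ioo_subset_Icc_self hy)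

lemma ae_eq_deriv (hab : a ≤ b) (h : IsPrimitiveOn F f a b) :
    ∀ᵐ x ∂(volume.restrict (Ioo a b)), deriv F x = f x :=
  (h.ae_hasDerivAt hab).mono fun _ hx => hx.deriv

lemma _root_.intervalIntegrable_congr_ae_Ioo {E : Type*} [NormedAddCommGroup E] {f g : ℝ → E}
    {a b : ℝ} (hab : a ≤ b) (h : f =ᵐ[volume.restrict (Ioo a b)] g)
    (hf : IntervalIntegrable f volume a b) : IntervalIntegrable g volume a b := by
  rw [intervalIntegrable_iff_integrableOn_Ioo_of_le hab] at hf ⊢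
  exact Integrable.congr hf h

lemma _root_.intervalIntegral_congr_ae_Ioo {E : Type*} [NormedAddCommGroup E] [NormedSpace ℝ E]
    {f g : ℝ → E} {a b x : ℝ}
    (h : f =ᵐ[volume.restrict (Ioo a b)] g) (hx : x ∈ Icc a b) :
    ∫ t in a..x, f t = ∫ t in a..x, g t := by
  rw [intervalIntegral.integral_of_le hx.1, intervalIntegral.integral_of_le hx.1,
    ← restrict_Ioo_eq_restrict_Ioc]
  exact integral_congr_ae
    (ae_mono (Measure.restrict_mono (Ioo_subset_Ioo_right hx.2) le_rfl) h)

lemma congr (h : IsPrimitiveOn F f a b) (hF : EqOn G F (Icc a b))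
    (hf : f =ᵐ[volume.restrict (Ioo a b)] g) (hab : a ≤ b) : IsPrimitiveOn G g a b := by
  refine ⟨intervalIntegrable_congr_ae_Ioo hab hf h.integrable, fun x hx => ?_⟩
  rw [hF hx, hF (left_mem_Icc.2 hab), h.eq_add x hx, intervalIntegral_congr_ae_Ioo hf hx]

/-- The fundamental theorem of calculus, applied to real and imaginary parts. Integrability of `f`
is part of the conclusion, since derivatives of absolutely continuous functions are integrable. -/
lemma _root_.AbsolutelyContinuousOnInterval.isPrimitiveOn (hab : a ≤ b)
    (hF : AbsolutelyContinuousOnInterval F a b)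
    (hd : ∀ᵐ x ∂(volume.restrict (Ioo a b)), HasDerivAt F (f x) x) : IsPrimitiveOn F f a b := by
  have hr : (deriv fun x => (F x).re) =ᵐ[volume.restrict (Ioo a b)] fun x => (f x).re :=
    hd.mono fun x hx => (Complex.reCLM.hasFDerivAt.comp_hasDerivAt x hx).deriv
  have hi : (deriv fun x => (F x).im) =ᵐ[volume.restrict (Ioo a b)] fun x => (f x).im :=
    hd.mono fun x hx => (Complex.imCLM.hasFDerivAt.comp_hasDerivAt x hx).deriv
  have ir := intervalIntegrable_congr_ae_Ioo hab hr hF.re.intervalIntegrable_deriv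
  have ii := intervalIntegrable_congr_ae_Ioo hab hi hF.im.intervalIntegrable_deriv
  have hf : IntervalIntegrable f volume a b := by
    have h1 : IntervalIntegrable (fun x => ((f x).re : ℂ)) volume a b := ⟨ir.1.ofReal, ir.2.ofReal⟩
    have h2 : IntervalIntegrable (fun x => ((f x).im : ℂ)) volume a b := ⟨ii.1.ofReal, ii.2.ofReal⟩
    have := h1.add (h2.mul_const Complex.I)
    simpa [Complex.re_add_im] using this
  refine ⟨hf, fun x hx => ?_⟩
  have hx' : uIcc a x ⊆ uIcc a b := by
    rw [uIcc_of_le hx.1, uIcc_of_le hab]; exact Icc_subset_Icc_right hx.2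
  have hfx := hf.mono_set hx'
  have e1 := (hF.re.mono hx').integral_deriv_eq_sub
  have e2 := (hF.im.mono hx').integral_deriv_eq_sub
  rw [intervalIntegral_congr_ae_Ioo hr hx] at e1
  rw [intervalIntegral_congr_ae_Ioo hi hx] at e2
  have c1 : ∫ t in a..x, (f t).re = (∫ t in a..x, f t).re :=
    Complex.reCLM.intervalIntegral_comp_comm hfx
  have c2 : ∫ t in a..x, (f t).im = (∫ t in a..x, f t).im :=
    Complex.imCLM.intervalIntegral_comp_comm hfx
  apply Complex.ext
  · rw [Complex.add_re, ← c1, e1]; ring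
  · rw [Complex.add_im, ← c2, e2]; ring

lemma const (c : ℂ) (a b : ℝ) : IsPrimitiveOn (fun _ => c) (fun _ => 0) a b :=
  ⟨by simp, by simp⟩

lemma intervalIntegral (hf : IntervalIntegrable f volume a b) :
    IsPrimitiveOn (fun x => ∫ t in a..x, f t) f a b := ⟨hf, by simp⟩

lemma add (hF : IsPrimitiveOn F f a b) (hG : IsPrimitiveOn G g a b) :
    IsPrimitiveOn (fun x => F x + G x) (fun x => f x + g x) a b := by
  refine ⟨hF.integrable.add hG.integrable, fun x hx => ?_⟩
  rw [intervalIntegral.integral_add (hF.integrable_to hx) (hG.integrable_to hx),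
    hF.eq_add x hx, hG.eq_add x hx]; ring

lemma const_mul (c : ℂ) (hF : IsPrimitiveOn F f a b) :
    IsPrimitiveOn (fun x => c * F x) (fun x => c * f x) a b := by
  refine ⟨hF.integrable.const_mul c, fun x hx => ?_⟩
  rw [intervalIntegral.integral_const_mul, hF.eq_add x hx]; ring

lemma sub (hF : IsPrimitiveOn F f a b) (hG : IsPrimitiveOn G g a b) :
    IsPrimitiveOn (fun x => F x - G x) (fun x => f x - g x) a b := by
  refine ⟨hF.integrable.sub hG.integrable, fun x hx => ?_⟩
  rw [intervalIntegral.integral_sub (hF.integrable_to hx) (hG.integrable_to hx),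
    hF.eq_add x hx, hG.eq_add x hx]; ring

lemma star_conj (hF : IsPrimitiveOn F f a b) :
    IsPrimitiveOn (fun x => conj (F x)) (fun x => conj (f x)) a b := by
  have h : ∀ {x}, IntervalIntegrable f volume a x →
      ∫ t in a..x, conj (f t) = conj (∫ t in a..x, f t) := fun hx =>
    Complex.conjCLE.toContinuousLinearMap.intervalIntegral_comp_comm hx
  refine ⟨⟨?_, ?_⟩, fun x hx => ?_⟩
  · exact Complex.conjCLE.toContinuousLinearMap.integrable_comp hF.integrable.1
  · exact Complex.conjCLE.toContinuousLinearMap.integrable_comp hF.integrable.2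
  · rw [h (hF.integrable_to hx), hF.eq_add x hx, map_add]

/-- Through `integral_eq`, this product rule serves as integration by parts. -/
lemma mul (hab : a ≤ b) (hF : IsPrimitiveOn F f a b) (hG : IsPrimitiveOn G g a b) :
    IsPrimitiveOn (fun x => F x * G x) (fun x => f x * G x + F x * g x) a b := by
  refine ((hF.ac hab).smul (hG.ac hab)).isPrimitiveOn hab ?_
  filter_upwards [hF.ae_hasDerivAt hab, hG.ae_hasDerivAt hab] with x h1 h2
  exact h1.mul h2

lemma eqOn_const (hF : IsPrimitiveOn F f a b) (hf : f =ᵐ[volume.restrict (Ioo a b)] 0) :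
    ∀ x ∈ Icc a b, F x = F a := by
  intro x hx
  rw [hF.eq_add x hx, intervalIntegral_congr_ae_Ioo hf hx]
  simp

end IsPrimitiveOn

lemma IntervalIntegrable.mul_continuousOn_Icc {f g : ℝ → ℂ} {a b : ℝ} (hab : a ≤ b)
    (hf : IntervalIntegrable f volume a b) (hg : ContinuousOn g (Icc a b)) :
    IntervalIntegrable (fun x => f x * g x) volume a b :=
  hf.mul_continuousOn (by rwa [uIcc_of_le hab])

/-! ## Linear systems of first order with integrable coefficients -/

/-- The iterated integrals of an integrable function `γ ≥ 0` are controlled by the powers of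
its primitive. -/
lemma integral_mul_pow_le {γ : ℝ → ℝ} {a b : ℝ} (hab : a ≤ b)
    (hγ : IntervalIntegrable γ volume a b) (n : ℕ) {x : ℝ} (hx : x ∈ Icc a b) :
    ∫ t in a..x, γ t * (∫ s in a..t, γ s) ^ n = (∫ t in a..x, γ t) ^ (n + 1) / (n + 1) := by
  have hx' : uIcc a x ⊆ uIcc a b := by
    rw [uIcc_of_le hx.1, uIcc_of_le hab]; exact Icc_subset_Icc_right hx.2
  have hγx := hγ.mono_set hx'
  have ac : AbsolutelyContinuousOnInterval (fun t => ∫ s in a..t, γ s) a x :=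
    hγx.absolutelyContinuousOnInterval_intervalIntegral left_mem_uIcc
  have acn : ∀ k : ℕ, AbsolutelyContinuousOnInterval (fun t => (∫ s in a..t, γ s) ^ (k + 1)) a x := by
    intro k
    induction k with
    | zero => simpa using ac
    | succ k ih => 
      simp only [pow_succ _ (k + 1)]
      exact ih.mul ac
  have hd : (deriv fun t => (∫ s in a..t, γ s) ^ (n + 1)) =ᵐ[volume.restrict (Ioo a x)]
      fun t => (n + 1) * (γ t * (∫ s in a..t, γ s) ^ n) := by
    rw [Filter.EventuallyEq, ae_restrict_iff' measurableSet_Ioo]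
    filter_upwards [hγx.ae_hasDerivAt_integral] with t ht ht'
    have := (ht (by rw [uIcc_of_le hx.1]; exact Ioo_subset_Icc_self ht') a left_mem_uIcc).pow
      (n + 1)
    rw [HasDerivAt.deriv (f := fun t => (∫ s in a..t, γ s) ^ (n + 1)) this]
    push_cast
    ring
  have e := (acn n).integral_deriv_eq_sub
  rw [intervalIntegral_congr_ae_Ioo hd ⟨hx.1, le_rfl⟩, intervalIntegral.integral_const_mul] at e
  have hn : ((n : ℝ) + 1) ≠ 0 := by positivity
  rw [eq_div_iff hn, mul_comm]
  simpa using e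

section InitialValueProblem

variable {a b : ℝ}

/-- The Picard map of the initial value problem `g' = α v`, `v' = β g`. -/
def picardMap (hab : a ≤ b) {α β : ℝ → ℂ} (hα : IntervalIntegrable α volume a b)
    (hβ : IntervalIntegrable β volume a b) (g₀ v₀ : ℂ) (y : C(Icc a b, ℂ) × C(Icc a b, ℂ)) :
    C(Icc a b, ℂ) × C(Icc a b, ℂ) :=
  (⟨fun x => g₀ + ∫ t in a..x, α t * IccExtend hab y.2 t, by
      have h := (IsPrimitiveOn.intervalIntegral (hα.mul_continuousOn_Icc hab
        (y.2.continuous.Icc_extend' (h := hab)).continuousOn)).continuousOn hab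
      exact continuous_const.add (continuousOn_iff_continuous_domRestrict.1 h)⟩,
    ⟨fun x => v₀ + ∫ t in a..x, β t * IccExtend hab y.1 t, by
      have h := (IsPrimitiveOn.intervalIntegral (hβ.mul_continuousOn_Icc hab
        (y.1.continuous.Icc_extend' (h := hab)).continuousOn)).continuousOn hab
      exact continuous_const.add (continuousOn_iff_continuous_domRestrict.1 h)⟩)

/-- One Picard step gains one power of the primitive of `γ` and one factor of the factorial, by
`integral_mul_pow_le`. The two components feed each other, so the estimate passes from one component
to the other. -/
lemma norm_integral_mul_sub_le (hab : a ≤ b) {α : ℝ → ℂ} {γ : ℝ → ℝ}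
    (hα : IntervalIntegrable α volume a b) (hγ : IntervalIntegrable γ volume a b)
    (hαγ : ∀ t, ‖α t‖ ≤ γ t) {y z : C(Icc a b, ℂ)} {n : ℕ} {D : ℝ}
    (hyz : ∀ x : Icc a b, ‖y x - z x‖ ≤ (∫ t in a..x, γ t) ^ n / n.factorial * D)
    (x : Icc a b) :
    ‖(∫ t in a..x, α t * IccExtend hab y t) - ∫ t in a..x, α t * IccExtend hab z t‖ ≤
      (∫ t in a..x, γ t) ^ (n + 1) / (n + 1).factorial * D := by
  obtain ⟨x, hx⟩ := x
  have hx' : uIcc a x ⊆ uIcc a b := by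
    rw [uIcc_of_le hx.1, uIcc_of_le hab]; exact Icc_subset_Icc_right hx.2
  have iy : ∀ y : C(Icc a b, ℂ), IntervalIntegrable (fun t => α t * IccExtend hab y t) volume a x :=
    fun y => (hα.mono_set hx').mul_continuousOn
      (y.continuous.Icc_extend' (h := hab)).continuousOn
  have hcont : ContinuousOn (fun t => (∫ s in a..t, γ s) ^ n) (uIcc a x) :=
    (((hγ.mono_set hx').absolutelyContinuousOnInterval_intervalIntegral
      left_mem_uIcc).continuousOn).pow n
  rw [← intervalIntegral.integral_sub (iy y) (iy z)]
  calc ‖∫ t in a..x, (α t * IccExtend hab y t - α t * IccExtend hab z t)‖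
      ≤ ∫ t in a..x, γ t * (∫ s in a..t, γ s) ^ n * (D / n.factorial) := by
        refine intervalIntegral.norm_integral_le_of_norm_le hx.1
          (Filter.Eventually.of_forall fun t ht => ?_)
          (((hγ.mono_set hx').mul_continuousOn hcont).mul_const _)
        have ht' : t ∈ Icc a b := ⟨ht.1.le, ht.2.trans hx.2⟩
        rw [← mul_sub, norm_mul, IccExtend_of_mem hab _ ht', IccExtend_of_mem hab _ ht']
        have h1 := hyz ⟨t, ht'⟩
        calc ‖α t‖ * ‖y ⟨t, ht'⟩ - z ⟨t, ht'⟩‖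
            ≤ γ t * ((∫ t in a..t, γ t) ^ n / n.factorial * D) :=
              mul_le_mul (hαγ t) h1 (norm_nonneg _) ((norm_nonneg _).trans (hαγ t))
          _ = _ := by ring
    _ = _ := by
        rw [intervalIntegral.integral_mul_const, integral_mul_pow_le hab hγ n hx,
          Nat.factorial_succ]
        push_cast
        field_simp

/-- Existence for the initial value problem `g' = α v`, `v' = β g` with integrable
coefficients. -/
theorem exists_linear_system_solution (hab : a ≤ b) {α β : ℝ → ℂ}
    (hα : IntervalIntegrable α volume a b) (hβ : IntervalIntegrable β volume a b) (g₀ v₀ : ℂ) :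
    ∃ g v : ℝ → ℂ, IsPrimitiveOn g (fun x => α x * v x) a b ∧
      IsPrimitiveOn v (fun x => β x * g x) a b ∧ g a = g₀ ∧ v a = v₀ := by
  -- A common majorant of both coefficients, so that one bound serves both components throughout the
  -- iteration.
  set γ : ℝ → ℝ := fun t => ‖α t‖ + ‖β t‖ with hγd
  have hγ : IntervalIntegrable γ volume a b := hα.norm.add hβ.norm
  have hαγ : ∀ t, ‖α t‖ ≤ γ t := fun t => le_add_of_nonneg_right (norm_nonneg _)
  have hβγ : ∀ t, ‖β t‖ ≤ γ t := fun t => le_add_of_nonneg_left (norm_nonneg _)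
  set T := picardMap hab hα hβ g₀ v₀ with hT
  have hm : ∀ x ∈ Icc a b, 0 ≤ ∫ t in a..x, γ t ∧ ∫ t in a..x, γ t ≤ ∫ t in a..b, γ t := by
    intro x hx
    have hp : ∀ t, 0 ≤ γ t := fun t => by positivity
    exact ⟨intervalIntegral.integral_nonneg hx.1 fun t _ => hp t,
      intervalIntegral.integral_mono_interval le_rfl hx.1 hx.2
        (Filter.Eventually.of_forall fun t => hp t) hγ⟩
  have hit : ∀ (n : ℕ) (y z : C(Icc a b, ℂ) × C(Icc a b, ℂ)) (x : Icc a b),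
      ‖(T^[n] y).1 x - (T^[n] z).1 x‖ ≤ (∫ t in a..x, γ t) ^ n / n.factorial * dist y z ∧
      ‖(T^[n] y).2 x - (T^[n] z).2 x‖ ≤ (∫ t in a..x, γ t) ^ n / n.factorial * dist y z := by
    intro n y z
    induction n with
    | zero =>
      intro x
      simp only [Function.iterate_zero, id, pow_zero, Nat.factorial_zero, Nat.cast_one, div_one,
        one_mul, ← dist_eq_norm]
      exact ⟨(ContinuousMap.dist_apply_le_dist x).trans (le_max_left _ _),
        (ContinuousMap.dist_apply_le_dist x).trans (le_max_right _ _)⟩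
    | succ n ih =>
      intro x
      rw [Function.iterate_succ_apply', Function.iterate_succ_apply']
      refine ⟨?_, ?_⟩
      · have := norm_integral_mul_sub_le hab hα hγ hαγ (fun x => (ih x).2) x
        simpa only [hT, picardMap, ContinuousMap.coe_mk, add_sub_add_left_eq_sub] using this
      · have := norm_integral_mul_sub_le hab hβ hγ hβγ (fun x => (ih x).1) x
        simpa only [hT, picardMap, ContinuousMap.coe_mk, add_sub_add_left_eq_sub] using this
  set M := ∫ t in a..b, γ t with hM
  have hM0 : 0 ≤ M := (hm b ⟨hab, le_rfl⟩).1
  -- `T` itself need not contract, but `M ^ n / n!` tends to zero, so some iterate does.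
  obtain ⟨n, hn⟩ : ∃ n : ℕ, M ^ n / n.factorial < 1 :=
    ((FloorSemiring.tendsto_pow_div_factorial_atTop M).eventually_lt_const one_pos).exists
  have hK0 : 0 ≤ M ^ n / n.factorial := by positivity
  have hlip : ∀ y z, dist (T^[n] y) (T^[n] z) ≤ M ^ n / n.factorial * dist y z := by
    intro y z
    have hle : ∀ x : Icc a b, (∫ t in a..x, γ t) ^ n / n.factorial * dist y z ≤
        M ^ n / n.factorial * dist y z := fun x => by
      have := hm x x.2
      gcongr
      exacts [this.1, this.2]
    rw [Prod.dist_eq]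
    refine max_le ?_ ?_
    · rw [ContinuousMap.dist_le (by positivity)]
      intro x
      rw [dist_eq_norm]
      exact (hit n y z x).1.trans (hle x)
    · rw [ContinuousMap.dist_le (by positivity)]
      intro x
      rw [dist_eq_norm]
      exact (hit n y z x).2.trans (hle x)
  have hc : ContractingWith ⟨M ^ n / n.factorial, hK0⟩ T^[n] :=
    ⟨by exact_mod_cast hn, LipschitzWith.of_dist_le_mul hlip⟩
  -- The unique fixed point of the iterate is also fixed by `T`.
  have hfix := hc.isFixedPt_fixedPoint_iterate
  set y := ContractingWith.fixedPoint T^[n] hc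
  have h1 : ∀ x : Icc a b, y.1 x = g₀ + ∫ t in a..x, α t * IccExtend hab y.2 t := fun x => by
    conv_lhs => rw [← hfix]
    rfl
  have h2 : ∀ x : Icc a b, y.2 x = v₀ + ∫ t in a..x, β t * IccExtend hab y.1 t := fun x => by
    conv_lhs => rw [← hfix]
    rfl
  have ha : a ∈ Icc a b := ⟨le_rfl, hab⟩
  have ga : IccExtend hab y.1 a = g₀ := by rw [IccExtend_of_mem hab _ ha, h1]; simp
  have va : IccExtend hab y.2 a = v₀ := by rw [IccExtend_of_mem hab _ ha, h2]; simp
  refine ⟨IccExtend hab y.1, IccExtend hab y.2, ⟨?_, fun x hx => ?_⟩, ⟨?_, fun x hx => ?_⟩, ga, va⟩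
  · exact hα.mul_continuousOn_Icc hab (y.2.continuous.Icc_extend' (h := hab)).continuousOn
  · rw [ga, IccExtend_of_mem hab _ hx, h1]
  · exact hβ.mul_continuousOn_Icc hab (y.1.continuous.Icc_extend' (h := hab)).continuousOn
  · rw [va, IccExtend_of_mem hab _ hx, h2]

end InitialValueProblem

namespace SturmLiouville

/-! ## The weighted measure -/

section Weight

variable (S : SturmLiouville)

lemma aemeasurable_weight :
    AEMeasurable (fun x => ENNReal.ofReal (S.r x)) (volume.restrict (Ioo S.a S.b)) :=
  S.r_integrable.aemeasurable.ennreal_ofReal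

instance : IsFiniteMeasure S.weight :=
  isFiniteMeasure_withDensity_ofReal S.r_integrable.hasFiniteIntegral

lemma ae_weight_mem : ∀ᵐ x ∂S.weight, x ∈ Ioo S.a S.b :=
  S.ae_weight (ae_restrict_mem measurableSet_Ioo)

lemma weight_smul_ae (F : ℝ → ℂ) :
    (fun x => (ENNReal.ofReal (S.r x)).toReal • F x) =ᵐ[volume.restrict (Ioo S.a S.b)]
      fun x => (S.r x : ℂ) * F x := by
  filter_upwards [S.r_pos] with x hx
  rw [ENNReal.toReal_ofReal hx.le, Complex.real_smul]

lemma left_mem : S.a ∈ Icc S.a S.b := left_mem_Icc.2 S.hab.le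

lemma right_mem : S.b ∈ Icc S.a S.b := right_mem_Icc.2 S.hab.le

lemma intervalIntegrable_weight {F : ℝ → ℂ} (hF : Integrable F S.weight) :
    IntervalIntegrable (fun x => (S.r x : ℂ) * F x) volume S.a S.b := by
  rw [intervalIntegrable_iff_integrableOn_Ioo_of_le S.hab.le]
  exact ((integrable_withDensity_iff_integrable_smul₀' S.aemeasurable_weight (by simp)).1
    hF).congr (S.weight_smul_ae F)

lemma setIntegral_weight (F : ℝ → ℂ) {x : ℝ} (hx : x ∈ Icc S.a S.b) :
    ∫ t in Ioc S.a x, F t ∂S.weight = ∫ t in S.a..x, (S.r t : ℂ) * F t := by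
  have hsub : Ioc S.a x ∩ Ioc S.a S.b = Ioc S.a x :=
    inter_eq_left.2 (Ioc_subset_Ioc_right hx.2)
  have e : (volume.restrict (Ioo S.a S.b)).restrict (Ioc S.a x) = volume.restrict (Ioc S.a x) := by
    rw [restrict_Ioo_eq_restrict_Ioc, Measure.restrict_restrict measurableSet_Ioc, hsub]
  have hle : volume.restrict (Ioc S.a x) ≤ volume.restrict (Ioo S.a S.b) := by
    rw [← e]; exact Measure.restrict_le_self
  rw [weight, restrict_withDensity measurableSet_Ioc, e, intervalIntegral.integral_of_le hx.1,
    integral_withDensity_eq_integral_toReal_smul₀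
      (S.aemeasurable_weight.mono_measure hle) (by simp)]
  exact integral_congr_ae (ae_mono hle (S.weight_smul_ae F))

lemma integral_weight (F : ℝ → ℂ) :
    ∫ t, F t ∂S.weight = ∫ t in S.a..S.b, (S.r t : ℂ) * F t := by
  rw [← S.setIntegral_weight F S.right_mem, Measure.restrict_eq_self_of_ae_mem]
  exact S.ae_weight_mem.mono fun x hx => Ioo_subset_Ioc_self hx

lemma inner_eq {f g : S.L2} {F G : ℝ → ℂ} (hf : f =ᵐ[S.weight] F) (hg : g =ᵐ[S.weight] G) :
    inner ℂ f g = ∫ t in S.a..S.b, (S.r t : ℂ) * (conj (F t) * G t) := by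
  rw [L2.inner_def, ← S.integral_weight]
  refine integral_congr_ae ?_
  filter_upwards [hf, hg] with x h1 h2
  rw [h1, h2, RCLike.inner_apply, mul_comm]

lemma memLp_continuousOn {g : ℝ → ℂ} (hg : ContinuousOn g (Icc S.a S.b)) :
    MemLp g 2 S.weight := by
  obtain ⟨C, hC⟩ := isCompact_Icc.exists_bound_of_continuousOn hg
  refine MemLp.of_bound ?_ C (S.ae_weight_mem.mono fun x hx => hC x (Ioo_subset_Icc_self hx))
  exact ((hg.mono Ioo_subset_Icc_self).aestronglyMeasurable measurableSet_Ioo).mono_ac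
    (withDensity_absolutelyContinuous _ _)

lemma exists_L2 {g : ℝ → ℂ} (hg : ContinuousOn g (Icc S.a S.b)) :
    ∃ f : S.L2, f =ᵐ[S.weight] g :=
  ⟨(S.memLp_continuousOn hg).toLp g, MemLp.coeFn_toLp _⟩

lemma integrable_L2 (f : S.L2) : Integrable f S.weight :=
  (Lp.memLp f).integrable (by norm_num)

/-- Since `r > 0` almost everywhere, null sets of the weight are Lebesgue null in `(a, b)`. An `L²`
class thus has at most one continuous representative on `[a, b]`, and its endpoint values make
sense. -/
lemma eqOn_of_ae_weight {g k : ℝ → ℂ} (hg : ContinuousOn g (Icc S.a S.b))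
    (hk : ContinuousOn k (Icc S.a S.b)) (h : g =ᵐ[S.weight] k) : EqOn g k (Icc S.a S.b) := by
  have h1 : EqOn g k (Ioo S.a S.b) :=
    Measure.eqOn_Ioo_of_ae_eq (μ := volume) (S.ae_of_ae_weight h)
      (hg.mono Ioo_subset_Icc_self) (hk.mono Ioo_subset_Icc_self)
  refine h1.of_subset_closure hg hk Ioo_subset_Icc_self ?_
  rw [closure_Ioo S.hab.ne]

lemma ae_eq_of_eqOn {g k : ℝ → ℂ} (h : EqOn g k (Icc S.a S.b)) : g =ᵐ[S.weight] k :=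
  S.ae_weight_mem.mono fun _ hx => h (Ioo_subset_Icc_self hx)

lemma ae_restrict_of_eqOn {g k : ℝ → ℂ} (h : EqOn g k (Icc S.a S.b)) :
    g =ᵐ[volume.restrict (Ioo S.a S.b)] k :=
  (ae_restrict_mem measurableSet_Ioo).mono fun _ hx => h (Ioo_subset_Icc_self hx)

end Weight

/-! ## Solutions of the inhomogeneous equation -/

/-- `-(v)' + q g = r h` and `v = p g'`, in integrated form. -/
structure SolvesWith (S : SturmLiouville) (g v h : ℝ → ℂ) : Prop where
  fst : IsPrimitiveOn g (fun x => ((1 / S.p x : ℝ) : ℂ) * v x) S.a S.b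
  snd : IsPrimitiveOn v (fun x => (S.q x : ℂ) * g x - (S.r x : ℂ) * h x) S.a S.b

variable {S : SturmLiouville}

namespace SolvesWith

variable {g v h g₁ v₁ h₁ g₂ v₂ h₂ : ℝ → ℂ}

lemma continuousOn (H : S.SolvesWith g v h) : ContinuousOn g (Icc S.a S.b) :=
  H.fst.continuousOn S.hab.le

lemma continuousOn_quasi (H : S.SolvesWith g v h) : ContinuousOn v (Icc S.a S.b) :=
  H.snd.continuousOn S.hab.le

lemma congr (H : S.SolvesWith g₁ v₁ h₁) (hg : EqOn g₂ g₁ (Icc S.a S.b))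
    (hv : EqOn v₂ v₁ (Icc S.a S.b)) (hh : h₂ =ᵐ[S.weight] h₁) : S.SolvesWith g₂ v₂ h₂ := by
  refine ⟨H.fst.congr hg ?_ S.hab.le, H.snd.congr hv ?_ S.hab.le⟩
  · filter_upwards [S.ae_restrict_of_eqOn hv] with x hx
    rw [hx]
  · filter_upwards [S.ae_restrict_of_eqOn hg, S.ae_of_ae_weight hh] with x hx hx'
    rw [hx, hx']

lemma add (H₁ : S.SolvesWith g₁ v₁ h₁) (H₂ : S.SolvesWith g₂ v₂ h₂) :
    S.SolvesWith (fun x => g₁ x + g₂ x) (fun x => v₁ x + v₂ x) (fun x => h₁ x + h₂ x) := by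
  refine ⟨?_, ?_⟩
  · convert H₁.fst.add H₂.fst using 2 with x
    ring
  · convert H₁.snd.add H₂.snd using 2 with x
    ring

lemma sub (H₁ : S.SolvesWith g₁ v₁ h₁) (H₂ : S.SolvesWith g₂ v₂ h₂) :
    S.SolvesWith (fun x => g₁ x - g₂ x) (fun x => v₁ x - v₂ x) (fun x => h₁ x - h₂ x) := by
  refine ⟨?_, ?_⟩
  · convert H₁.fst.sub H₂.fst using 2 with x
    ring
  · convert H₁.snd.sub H₂.snd using 2 with x
    ring

lemma const_mul (c : ℂ) (H : S.SolvesWith g v h) :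
    S.SolvesWith (fun x => c * g x) (fun x => c * v x) (fun x => c * h x) := by
  refine ⟨?_, ?_⟩
  · convert H.fst.const_mul c using 2 with x
    ring
  · convert H.snd.const_mul c using 2 with x
    ring

lemma star_conj (H : S.SolvesWith g v h) :
    S.SolvesWith (fun x => conj (g x)) (fun x => conj (v x)) (fun x => conj (h x)) := by
  refine ⟨?_, ?_⟩
  · convert H.fst.star_conj using 2 with x
    rw [map_mul, Complex.conj_ofReal]
  · convert H.snd.star_conj using 2 with x
    rw [map_sub, map_mul, map_mul, Complex.conj_ofReal, Complex.conj_ofReal]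

/-- **Lagrange's identity**. -/
lemma lagrange (H₁ : S.SolvesWith g₁ v₁ h₁) (H₂ : S.SolvesWith g₂ v₂ h₂) :
    IsPrimitiveOn (fun x => g₁ x * v₂ x - v₁ x * g₂ x)
      (fun x => (S.r x : ℂ) * (h₁ x * g₂ x - g₁ x * h₂ x)) S.a S.b := by
  convert (H₁.fst.mul S.hab.le H₂.snd).sub (H₁.snd.mul S.hab.le H₂.fst) using 2 with x
  ring

end SolvesWith

lemma Represents.solvesWith {g v : ℝ → ℂ} {f h : S.L2} (H : S.Represents g v f h) :
    S.SolvesWith g v h := by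
  refine ⟨H.pair.ac.isPrimitiveOn S.hab.le ?_, H.pair.ac_quasi.isPrimitiveOn S.hab.le ?_⟩
  · filter_upwards [S.p_pos, H.pair.quasi_eq, H.pair.ac.ae_differentiableAt_complex S.hab.le]
      with x hp e d
    have hp' : (S.p x : ℂ) ≠ 0 := by exact_mod_cast hp.ne'
    have : deriv g x = ((1 / S.p x : ℝ) : ℂ) * v x := by
      rw [e]; push_cast; field_simp
    rw [← this]
    exact d.hasDerivAt
  · filter_upwards [S.r_pos, S.ae_of_ae_weight H.snd_eq,
      H.pair.ac_quasi.ae_differentiableAt_complex S.hab.le] with x hr e d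
    have hr' : (S.r x : ℂ) ≠ 0 := by exact_mod_cast hr.ne'
    have : deriv v x = (S.q x : ℂ) * g x - (S.r x : ℂ) * (h : ℝ → ℂ) x := by
      rw [e, tau]; field_simp; ring
    rw [← this]
    exact d.hasDerivAt

lemma SolvesWith.isQuasiPair {g v h : ℝ → ℂ} (H : S.SolvesWith g v h) : S.IsQuasiPair g v := by
  refine ⟨H.fst.ac S.hab.le, H.snd.ac S.hab.le, ?_⟩
  filter_upwards [S.p_pos, H.fst.ae_eq_deriv S.hab.le] with x hp e
  have hp' : (S.p x : ℂ) ≠ 0 := by exact_mod_cast hp.ne'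
  rw [e]; push_cast; field_simp

lemma SolvesWith.tau_eq {g v h : ℝ → ℂ} (H : S.SolvesWith g v h) :
    ∀ᵐ x ∂(volume.restrict (Ioo S.a S.b)), S.tau g v x = h x := by
  filter_upwards [S.r_pos, H.snd.ae_eq_deriv S.hab.le] with x hr e
  have hr' : (S.r x : ℂ) ≠ 0 := by exact_mod_cast hr.ne'
  rw [tau, e]; field_simp; ring

lemma SolvesWith.represents {g v : ℝ → ℂ} {f h : S.L2} (H : S.SolvesWith g v h)
    (hf : f =ᵐ[S.weight] g) : S.Represents g v f h :=
  ⟨H.isQuasiPair, hf, (S.ae_weight H.tau_eq).mono fun _ hx => hx.symm⟩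

lemma isSolution_iff {z : ℂ} {u v : ℝ → ℂ} :
    S.IsSolution z u v ↔ S.SolvesWith u v fun x => z * u x := by
  constructor
  · rintro ⟨hp, ht⟩
    refine ⟨hp.ac.isPrimitiveOn S.hab.le ?_, hp.ac_quasi.isPrimitiveOn S.hab.le ?_⟩
    · filter_upwards [S.p_pos, hp.quasi_eq, hp.ac.ae_differentiableAt_complex S.hab.le]
        with x hp e d
      have hp' : (S.p x : ℂ) ≠ 0 := by exact_mod_cast hp.ne'
      have : deriv u x = ((1 / S.p x : ℝ) : ℂ) * v x := by
        rw [e]; push_cast; field_simp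
      rw [← this]
      exact d.hasDerivAt
    · filter_upwards [S.r_pos, ht, hp.ac_quasi.ae_differentiableAt_complex S.hab.le] with x hr e d
      have hr' : (S.r x : ℂ) ≠ 0 := by exact_mod_cast hr.ne'
      have : deriv v x = (S.q x : ℂ) * u x - (S.r x : ℂ) * (z * u x) := by
        rw [← e, tau]; field_simp; ring
      rw [← this]
      exact d.hasDerivAt
  · exact fun H => ⟨H.isQuasiPair, H.tau_eq⟩

/-- `c, s` solve `τ u = z u`, with `(c, c^{[1]})(a) = (1, 0)` and `(s, s^{[1]})(a) = (0, 1)`. -/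
structure IsFundamentalSystem (S : SturmLiouville) (z : ℂ) (c c' s s' : ℝ → ℂ) : Prop where
  cos : S.SolvesWith c c' fun x => z * c x
  sin : S.SolvesWith s s' fun x => z * s x
  cos_a : c S.a = 1
  cos_quasi_a : c' S.a = 0
  sin_a : s S.a = 0
  sin_quasi_a : s' S.a = 1

lemma exists_solvesWith_eigen (S : SturmLiouville) (z g₀ v₀ : ℂ) :
    ∃ g v, S.SolvesWith g v (fun x => z * g x) ∧ g S.a = g₀ ∧ v S.a = v₀ := by
  have hα : IntervalIntegrable (fun x => ((1 / S.p x : ℝ) : ℂ)) volume S.a S.b := by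
    rw [intervalIntegrable_iff_integrableOn_Ioo_of_le S.hab.le]
    exact S.p_inv_integrable.ofReal
  have hβ : IntervalIntegrable (fun x => (S.q x : ℂ) - z * (S.r x : ℂ)) volume S.a S.b := by
    rw [intervalIntegrable_iff_integrableOn_Ioo_of_le S.hab.le]
    exact S.q_integrable.ofReal.sub (S.r_integrable.ofReal.const_mul z)
  obtain ⟨g, v, h1, h2, h3, h4⟩ := exists_linear_system_solution S.hab.le hα hβ g₀ v₀
  refine ⟨g, v, ⟨h1, ?_⟩, h3, h4⟩
  convert h2 using 2 with x
  ring

lemma exists_isFundamentalSystem (S : SturmLiouville) (z : ℂ) :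
    ∃ c c' s s', S.IsFundamentalSystem z c c' s s' := by
  obtain ⟨c, c', h1, h2, h3⟩ := S.exists_solvesWith_eigen z 1 0
  obtain ⟨s, s', h4, h5, h6⟩ := S.exists_solvesWith_eigen z 0 1
  exact ⟨c, c', s, s', h1, h4, h2, h3, h5, h6⟩

namespace IsFundamentalSystem

variable {z : ℂ} {c c' s s' : ℝ → ℂ}

/-- For two solutions with the same `z` the right side of Lagrange's identity is zero. -/
lemma wronskian (H : S.IsFundamentalSystem z c c' s s') :
    ∀ x ∈ Icc S.a S.b, c x * s' x - c' x * s x = 1 := by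
  intro x hx
  have h := (H.cos.lagrange H.sin).eqOn_const
    (Filter.Eventually.of_forall fun t => by simp; right; ring) x hx
  rw [h, H.cos_a, H.cos_quasi_a, H.sin_quasi_a]
  ring

/-- Representation of the solutions of `τ g = z g + f` (Duhamel's formula). -/
lemma eq_of_solvesWith (H : S.IsFundamentalSystem z c c' s s') {g v f : ℝ → ℂ}
    (hg : S.SolvesWith g v fun x => z * g x + f x) {x : ℝ} (hx : x ∈ Icc S.a S.b) :
    g x = c x * (g S.a + ∫ t in S.a..x, (S.r t : ℂ) * (f t * s t)) +
      s x * (v S.a - ∫ t in S.a..x, (S.r t : ℂ) * (f t * c t)) ∧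
    v x = c' x * (g S.a + ∫ t in S.a..x, (S.r t : ℂ) * (f t * s t)) +
      s' x * (v S.a - ∫ t in S.a..x, (S.r t : ℂ) * (f t * c t)) := by
  -- Lagrange's identity against `s` and against `c` gives two linear equations for `(g x, v x)`;
  -- the Wronskian is their determinant, so Cramer's rule solves them.
  have e1 := (hg.lagrange H.sin).eq_add x hx
  have e2 := (hg.lagrange H.cos).eq_add x hx
  have w := H.wronskian x hx
  have i1 : (fun t => (S.r t : ℂ) * ((z * g t + f t) * s t - g t * (z * s t))) =
      fun t => (S.r t : ℂ) * (f t * s t) := by funext t; ring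
  have i2 : (fun t => (S.r t : ℂ) * ((z * g t + f t) * c t - g t * (z * c t))) =
      fun t => (S.r t : ℂ) * (f t * c t) := by funext t; ring
  simp only [i1, i2, H.sin_a, H.sin_quasi_a, H.cos_a, H.cos_quasi_a] at e1 e2
  generalize (∫ t in S.a..x, (S.r t : ℂ) * (f t * s t)) = A at *
  generalize (∫ t in S.a..x, (S.r t : ℂ) * (f t * c t)) = B at *
  constructor
  · linear_combination (c x) * e1 - (s x) * e2 - g x * w
  · linear_combination (c' x) * e1 - (s' x) * e2 - v x * w

lemma eq_of_solvesWith_eigen (H : S.IsFundamentalSystem z c c' s s') {g v : ℝ → ℂ}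
    (hg : S.SolvesWith g v fun x => z * g x) {x : ℝ} (hx : x ∈ Icc S.a S.b) :
    g x = g S.a * c x + v S.a * s x ∧ v x = g S.a * c' x + v S.a * s' x := by
  have h := H.eq_of_solvesWith (f := fun _ => 0) (g := g) (v := v) (by simpa using hg) hx
  simp only [zero_mul, mul_zero, intervalIntegral.integral_zero, add_zero, sub_zero] at h
  rw [h.1, h.2]
  constructor <;> ring

/-- Existence of solutions of `τ g = z g + f`. -/
lemma exists_solvesWith (H : S.IsFundamentalSystem z c c' s s') {f : ℝ → ℂ}
    (hf : Integrable f S.weight) (g₀ v₀ : ℂ) :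
    ∃ g v, S.SolvesWith g v (fun x => z * g x + f x) ∧ g S.a = g₀ ∧ v S.a = v₀ := by
  have hr := S.intervalIntegrable_weight hf
  have is : IntervalIntegrable (fun t => (S.r t : ℂ) * (f t * s t)) volume S.a S.b := by
    simpa only [mul_assoc] using hr.mul_continuousOn_Icc S.hab.le H.sin.continuousOn
  have ic : IntervalIntegrable (fun t => (S.r t : ℂ) * (f t * c t)) volume S.a S.b := by
    simpa only [mul_assoc] using hr.mul_continuousOn_Icc S.hab.le H.cos.continuousOn
  have pA := (IsPrimitiveOn.const g₀ S.a S.b).add (IsPrimitiveOn.intervalIntegral is)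
  have pB := (IsPrimitiveOn.const v₀ S.a S.b).sub (IsPrimitiveOn.intervalIntegral ic)
  refine ⟨fun x => c x * (g₀ + ∫ t in S.a..x, (S.r t : ℂ) * (f t * s t)) +
      s x * (v₀ - ∫ t in S.a..x, (S.r t : ℂ) * (f t * c t)),
    fun x => c' x * (g₀ + ∫ t in S.a..x, (S.r t : ℂ) * (f t * s t)) +
      s' x * (v₀ - ∫ t in S.a..x, (S.r t : ℂ) * (f t * c t)), ⟨?_, ?_⟩, ?_, ?_⟩
  · convert (H.cos.fst.mul S.hab.le pA).add (H.sin.fst.mul S.hab.le pB) using 2 with x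
    ring
  · refine ((H.cos.snd.mul S.hab.le pA).add (H.sin.snd.mul S.hab.le pB)).congr
      (fun x _ => rfl) ?_ S.hab.le
    filter_upwards [ae_restrict_mem measurableSet_Ioo] with x hx
    -- Differentiating the varied coefficients leaves `r f (c' s - s' c)`, which is `-r f` by the
    -- Wronskian.
    have w := H.wronskian x (Ioo_subset_Icc_self hx)
    linear_combination (-(S.r x : ℂ) * f x) * w
  · simp [H.cos_a, H.sin_a]
  · simp [H.cos_quasi_a, H.sin_quasi_a]

lemma star_conj (H : S.IsFundamentalSystem z c c' s s') :
    S.IsFundamentalSystem (conj z) (fun x => conj (c x)) (fun x => conj (c' x))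
      (fun x => conj (s x)) (fun x => conj (s' x)) := by
  refine ⟨?_, ?_, by simp [H.cos_a], by simp [H.cos_quasi_a], by simp [H.sin_a],
    by simp [H.sin_quasi_a]⟩
  · simpa using H.cos.star_conj
  · simpa using H.sin.star_conj

lemma eqOn (H : S.IsFundamentalSystem z c c' s s') {d d' t t' : ℝ → ℂ}
    (K : S.IsFundamentalSystem z d d' t t') :
    EqOn d c (Icc S.a S.b) ∧ EqOn d' c' (Icc S.a S.b) ∧ EqOn t s (Icc S.a S.b) ∧
      EqOn t' s' (Icc S.a S.b) := by
  refine ⟨fun x hx => ?_, fun x hx => ?_, fun x hx => ?_, fun x hx => ?_⟩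
  · simpa [K.cos_a, K.cos_quasi_a] using (H.eq_of_solvesWith_eigen K.cos hx).1
  · simpa [K.cos_a, K.cos_quasi_a] using (H.eq_of_solvesWith_eigen K.cos hx).2
  · simpa [K.sin_a, K.sin_quasi_a] using (H.eq_of_solvesWith_eigen K.sin hx).1
  · simpa [K.sin_a, K.sin_quasi_a] using (H.eq_of_solvesWith_eigen K.sin hx).2

end IsFundamentalSystem

/-! ## The graphs of the realizations -/

lemma graph_mem_iff {M : Submodule ℂ BoundaryData} {f h : S.L2} :
    (f, h) ∈ (S.operatorWith M).graph ↔
      ∃ g v, S.SolvesWith g v h ∧ f =ᵐ[S.weight] g ∧ S.boundaryData g v ∈ M := by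
  rw [operatorWith_graph]
  constructor
  · rintro ⟨g, v, H, m⟩
    exact ⟨g, v, H.solvesWith, H.fst_eq, m⟩
  · rintro ⟨g, v, H, e, m⟩
    exact ⟨g, v, H.represents e, m⟩

/-- Equal functions have equal derivatives, and `1 / p ≠ 0` almost everywhere can be cancelled.
Hence the `L²` class determines the quasi-derivative, and with it all the boundary data. -/
lemma SolvesWith.eqOn_quasi {g₁ v₁ h₁ g₂ v₂ h₂ : ℝ → ℂ} (H₁ : S.SolvesWith g₁ v₁ h₁)
    (H₂ : S.SolvesWith g₂ v₂ h₂) (h : g₁ =ᵐ[S.weight] g₂) :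
    EqOn g₁ g₂ (Icc S.a S.b) ∧ EqOn v₁ v₂ (Icc S.a S.b) := by
  have hg := S.eqOn_of_ae_weight H₁.continuousOn H₂.continuousOn h
  refine ⟨hg, S.eqOn_of_ae_weight H₁.continuousOn_quasi H₂.continuousOn_quasi
    (S.ae_weight ?_)⟩
  filter_upwards [S.p_pos, H₁.fst.ae_hasDerivAt S.hab.le, H₂.fst.ae_hasDerivAt S.hab.le,
    ae_restrict_mem measurableSet_Ioo] with x hp d₁ d₂ hx
  have e : g₁ =ᶠ[nhds x] g₂ := by
    filter_upwards [Ioo_mem_nhds hx.1 hx.2] with y hy using hg (Ioo_subset_Icc_self hy)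
  have := (e.hasDerivAt_iff.1 d₁).unique d₂
  have hp' : ((1 / S.p x : ℝ) : ℂ) ≠ 0 := by
    exact_mod_cast (one_div_pos.2 hp).ne'
  exact mul_left_cancel₀ hp' this

/-- **Green's formula**. -/
lemma inner_sub_inner {g₁ v₁ g₂ v₂ : ℝ → ℂ} {f₁ h₁ f₂ h₂ : S.L2} (H₁ : S.SolvesWith g₁ v₁ h₁)
    (e₁ : f₁ =ᵐ[S.weight] g₁) (H₂ : S.SolvesWith g₂ v₂ h₂) (e₂ : f₂ =ᵐ[S.weight] g₂) :
    inner ℂ h₁ f₂ - inner ℂ f₁ h₂ =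
      (conj (g₁ S.b) * v₂ S.b - conj (v₁ S.b) * g₂ S.b) -
      (conj (g₁ S.a) * v₂ S.a - conj (v₁ S.a) * g₂ S.a) := by
  have L := H₁.star_conj.lagrange H₂
  rw [← L.integral_eq S.hab.le, S.inner_eq (ae_eq_refl _) e₂, S.inner_eq e₁ (ae_eq_refl _),
    ← intervalIntegral.integral_sub]
  · congr 1
    funext x
    ring
  · have h' := S.intervalIntegrable_weight (((Complex.conjCLE.toContinuousLinearMap).integrable_comp
      (S.integrable_L2 h₁)))
    simpa [mul_assoc] using h'.mul_continuousOn_Icc S.hab.le H₂.continuousOn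
  · have h' := (S.intervalIntegrable_weight (S.integrable_L2 h₂)).mul_continuousOn_Icc S.hab.le
      H₁.star_conj.continuousOn
    refine h'.congr fun x _ => ?_
    ring

end SturmLiouville

/-! ### Kernels and resolvents in terms of graphs -/

section Graphs

variable {H : Type*} [NormedAddCommGroup H] [InnerProductSpace ℂ H]

lemma mem_operatorKer_iff {A : H →ₗ.[ℂ] H} {f : H} : f ∈ operatorKer A ↔ (f, (0 : H)) ∈ A.graph := by
  rw [operatorKer, Submodule.mem_map, LinearPMap.mem_graph_iff]
  constructor
  · rintro ⟨y, hy, rfl⟩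
    exact ⟨y, rfl, hy⟩
  · rintro ⟨y, hy, h0⟩
    exact ⟨y, h0, hy⟩

lemma isResolventAt_iff {A : H →ₗ.[ℂ] H} {z : ℂ} {R : H →L[ℂ] H} :
    IsResolventAt A z R ↔ (∀ f, (R f, f + z • R f) ∈ A.graph) ∧
      ∀ g h, (g, h) ∈ A.graph → R (h - z • g) = g := by
  refine and_congr (forall_congr' fun f => ?_) ⟨fun h g k hg => ?_, fun h g => h _ _ (A.mem_graph g)⟩
  · rw [LinearPMap.mem_graph_iff]
    constructor
    · rintro ⟨hd, e⟩
      exact ⟨⟨R f, hd⟩, rfl, sub_eq_iff_eq_add.1 e⟩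
    · rintro ⟨⟨y, hd⟩, rfl, e⟩
      exact ⟨hd, sub_eq_iff_eq_add.2 e⟩
  · obtain ⟨y, rfl, rfl⟩ := (LinearPMap.mem_graph_iff A).1 hg
    exact h y

end Graphs

namespace SturmLiouville

variable {S : SturmLiouville} {z : ℂ} {c c' s s' : ℝ → ℂ}

/-! ## The adjoint of the minimal operator -/

lemma mem_graph_Hmin_iff {f h : S.L2} : (f, h) ∈ S.Hmin.graph ↔
    ∃ g v, S.SolvesWith g v h ∧ f =ᵐ[S.weight] g ∧
      g S.a = 0 ∧ v S.a = 0 ∧ g S.b = 0 ∧ v S.b = 0 := by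
  rw [Hmin, graph_mem_iff]
  refine exists_congr fun g => exists_congr fun v => and_congr_right fun _ =>
    and_congr_right fun _ => ?_
  rw [Submodule.mem_bot, boundaryData, Prod.ext_iff, funext_iff, funext_iff]
  simp [Fin.forall_fin_two, and_assoc]

lemma mem_graph_Hmax_iff {f h : S.L2} : (f, h) ∈ S.Hmax.graph ↔
    ∃ g v, S.SolvesWith g v h ∧ f =ᵐ[S.weight] g := by
  rw [Hmax, graph_mem_iff]
  simp

lemma mem_graph_HDirichlet_iff {f h : S.L2} : (f, h) ∈ S.HDirichlet.graph ↔
    ∃ g v, S.SolvesWith g v h ∧ f =ᵐ[S.weight] g ∧ g S.a = 0 ∧ g S.b = 0 := by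
  rw [HDirichlet, graph_mem_iff]
  rfl

namespace IsFundamentalSystem

/-- The coefficients and the data at `a` are real, so conjugation yields the fundamental system at
`conj z`; uniqueness does the rest. -/
lemma conj_eqOn (H : S.IsFundamentalSystem z c c' s s') (hz : conj z = z) :
    (∀ x ∈ Icc S.a S.b, conj (c x) = c x) ∧ (∀ x ∈ Icc S.a S.b, conj (c' x) = c' x) ∧
      (∀ x ∈ Icc S.a S.b, conj (s x) = s x) ∧ ∀ x ∈ Icc S.a S.b, conj (s' x) = s' x := by
  have K := H.star_conj
  rw [hz] at K
  exact H.eqOn K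

/-- With zero data at `a`, Duhamel's formula expresses the data at `b` through the two integrals, so
they vanish as well. The final clause keeps the explicit formula for the preimage, which the form
approximation needs. -/
lemma exists_Hmin (H : S.IsFundamentalSystem 0 c c' s s') {h : S.L2}
    (hc : ∫ t in S.a..S.b, (S.r t : ℂ) * ((h : ℝ → ℂ) t * c t) = 0)
    (hs : ∫ t in S.a..S.b, (S.r t : ℂ) * ((h : ℝ → ℂ) t * s t) = 0) :
    ∃ f : S.L2, (f, h) ∈ S.Hmin.graph ∧ ∀ g : ℝ → ℂ,
      (∀ x ∈ Icc S.a S.b, g x = c x * (∫ t in S.a..x, (S.r t : ℂ) * ((h : ℝ → ℂ) t * s t)) -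
        s x * (∫ t in S.a..x, (S.r t : ℂ) * ((h : ℝ → ℂ) t * c t))) → f =ᵐ[S.weight] g := by
  obtain ⟨g, v, hg, ga, va⟩ := H.exists_solvesWith (S.integrable_L2 h) 0 0
  obtain ⟨f, hf⟩ := S.exists_L2 hg.continuousOn
  have hb := H.eq_of_solvesWith hg S.right_mem
  simp only [hc, hs, ga, va, add_zero, sub_zero, mul_zero] at hb
  refine ⟨f, mem_graph_Hmin_iff.2 ⟨g, v, by simpa using hg, hf, ga, va, hb.1, hb.2⟩,
    fun k hk => hf.trans (S.ae_eq_of_eqOn fun x hx => ?_)⟩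
  rw [hk x hx, (H.eq_of_solvesWith hg hx).1, ga, va]
  ring

end IsFundamentalSystem

/-- A pair which is formally adjoint to the minimal operator lies in the graph of the maximal
operator. -/
lemma mem_graph_Hmax_of_formalAdjoint {f h : S.L2}
    (H : ∀ k l, (k, l) ∈ S.Hmin.graph → inner ℂ l f = inner ℂ k h) : (f, h) ∈ S.Hmax.graph := by
  obtain ⟨c, c', s, s', F⟩ := S.exists_isFundamentalSystem 0
  obtain ⟨w, y, hw, -, -⟩ := F.exists_solvesWith (S.integrable_L2 h) 0 0
  simp only [zero_mul, zero_add] at hw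
  obtain ⟨W, eW⟩ := S.exists_L2 hw.continuousOn
  obtain ⟨C, eC⟩ := S.exists_L2 F.cos.continuousOn
  obtain ⟨D, eD⟩ := S.exists_L2 F.sin.continuousOn
  obtain ⟨rc, -, rs, -⟩ := F.conj_eqOn (map_zero _)
  have hint : ∀ {u : ℝ → ℂ} {U l : S.L2}, U =ᵐ[S.weight] u →
      (∀ x ∈ Icc S.a S.b, conj (u x) = u x) →
      ∫ t in S.a..S.b, (S.r t : ℂ) * ((l : ℝ → ℂ) t * u t) = inner ℂ U l := by
    intro u U l hU hu
    rw [S.inner_eq hU (ae_eq_refl _)]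
    refine intervalIntegral.integral_congr fun x hx => ?_
    rw [uIcc_of_le S.hab.le] at hx
    simp only [hu x hx]
    ring
  -- `W` solves `τ W = h`, so by Green's formula `f - W` is orthogonal to the range of `Hmin`, which
  -- contains the orthogonal complement of `c` and `s`. The span of these two is finite-dimensional,
  -- hence equal to its double orthogonal.
  have key : f - W ∈ (Submodule.span ℂ {C, D} : Submodule ℂ S.L2) := by
    have : FiniteDimensional ℂ (Submodule.span ℂ {C, D} : Submodule ℂ S.L2) :=
      FiniteDimensional.span_of_finite ℂ (toFinite _)
    rw [← Submodule.orthogonal_orthogonal (Submodule.span ℂ {C, D})]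
    rw [Submodule.mem_orthogonal]
    intro l hl
    rw [Submodule.mem_orthogonal] at hl
    have h1 := hl C (Submodule.subset_span (by simp))
    have h2 := hl D (Submodule.subset_span (by simp))
    obtain ⟨k, hk, -⟩ := F.exists_Hmin ((hint eC rc).trans h1) ((hint eD rs).trans h2)
    obtain ⟨g, v, hg, eg, ga, va, gb, vb⟩ := mem_graph_Hmin_iff.1 hk
    have G := inner_sub_inner hg eg hw eW
    rw [inner_sub_right, H k l hk]
    simp only [ga, va, gb, vb, map_zero, zero_mul, sub_zero] at G
    rw [sub_eq_zero.1 G, sub_self]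
  obtain ⟨α, β, hαβ⟩ := Submodule.mem_span_pair.1 key
  refine mem_graph_Hmax_iff.2 ⟨_, _, (hw.add (F.cos.const_mul α)).add (F.sin.const_mul β) |>.congr
    (fun _ _ => rfl) (fun _ _ => rfl) (Filter.Eventually.of_forall fun x => by simp), ?_⟩
  have e : f = W + α • C + β • D := by rw [add_assoc, hαβ]; abel
  rw [e]
  filter_upwards [Lp.coeFn_add (W + α • C) (β • D), Lp.coeFn_add W (α • C), Lp.coeFn_smul α C,
    Lp.coeFn_smul β D, eW, eC, eD] with x e1 e2 e3 e4 e5 e6 e7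
  rw [e1, Pi.add_apply, e2, Pi.add_apply, e3, e4, Pi.smul_apply, Pi.smul_apply, e5, e6, e7]
  rfl

/-- For `h` orthogonal to the domain, `(0, h)` is formally adjoint to `Hmin`, hence in the graph of
`Hmax`; being a graph, this forces `h = 0`. -/
lemma dense_Hmin (S : SturmLiouville) : Dense (S.Hmin.domain : Set S.L2) := by
  rw [Submodule.dense_iff_topologicalClosure_eq_top, Submodule.topologicalClosure_eq_top_iff,
    Submodule.eq_bot_iff]
  intro h hh
  have h0 : ((0 : S.L2), h) ∈ S.Hmax.graph := mem_graph_Hmax_of_formalAdjoint fun k l hkl => by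
    rw [inner_zero_right, (Submodule.mem_orthogonal _ _).1 hh k
      (LinearPMap.mem_domain_of_mem_graph hkl)]
  exact LinearPMap.graph_fst_eq_zero_snd _ h0 rfl

lemma adjoint_Hmin (S : SturmLiouville) : S.Hmin.adjoint = S.Hmax := by
  apply LinearPMap.eq_of_eq_graph
  rw [LinearPMap.adjoint_graph_eq_graph_adjoint S.dense_Hmin]
  ext ⟨f, h⟩
  rw [Submodule.mem_adjoint_iff]
  constructor
  · exact fun H => mem_graph_Hmax_of_formalAdjoint fun k l hkl => sub_eq_zero.1 (H k l hkl)
  · intro H k l hkl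
    obtain ⟨g, v, hg, eg, ga, va, gb, vb⟩ := mem_graph_Hmin_iff.1 hkl
    obtain ⟨w, y, hw, ew⟩ := mem_graph_Hmax_iff.1 H
    rw [inner_sub_inner hg eg hw ew]
    simp [ga, va, gb, vb]

lemma mem_operatorKer_adjoint_iff {f : S.L2} : f ∈ operatorKer S.Hmin.adjoint ↔
    ∃ g v, S.SolvesWith g v (fun _ => 0) ∧ f =ᵐ[S.weight] g := by
  rw [mem_operatorKer_iff, adjoint_Hmin, mem_graph_Hmax_iff]
  have h0 : ((0 : S.L2) : ℝ → ℂ) =ᵐ[S.weight] fun _ => 0 := Lp.coeFn_zero _ _ _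
  exact ⟨fun ⟨g, v, hg, e⟩ => ⟨g, v, hg.congr (fun _ _ => rfl) (fun _ _ => rfl) h0.symm, e⟩,
    fun ⟨g, v, hg, e⟩ => ⟨g, v, hg.congr (fun _ _ => rfl) (fun _ _ => rfl) h0, e⟩⟩

/-! ## The Dirichlet operator -/

lemma graph_add_smul_ae {f G : S.L2} {g : ℝ → ℂ} (h : G =ᵐ[S.weight] g) (z : ℂ) :
    ((f + z • G : S.L2) : ℝ → ℂ) =ᵐ[S.weight] fun x => z * g x + (f : ℝ → ℂ) x := by
  filter_upwards [Lp.coeFn_add f (z • G), Lp.coeFn_smul z G, h] with x e1 e2 e3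
  rw [e1, Pi.add_apply, e2, Pi.smul_apply, e3, smul_eq_mul, add_comm]

/-- Otherwise `s` is a Dirichlet eigenfunction at `z`, which a resolvent sends to zero, contrary to
`s^{[1]}(a) = 1`. -/
lemma IsFundamentalSystem.sin_b_ne_zero (H : S.IsFundamentalSystem z c c' s s') {R : S.L2 →L[ℂ] S.L2}
    (hR : IsResolventAt S.HDirichlet z R) : s S.b ≠ 0 := by
  intro hb
  obtain ⟨D, eD⟩ := S.exists_L2 H.sin.continuousOn
  have hmem : (D, z • D) ∈ S.HDirichlet.graph := by
    refine mem_graph_HDirichlet_iff.2 ⟨s, s', H.sin.congr (fun _ _ => rfl) (fun _ _ => rfl) ?_, eD,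
      H.sin_a, hb⟩
    filter_upwards [Lp.coeFn_smul z D, eD] with x e1 e2
    rw [e1, Pi.smul_apply, e2, smul_eq_mul]
  have h0 := (isResolventAt_iff.1 hR).2 _ _ hmem
  rw [sub_self, map_zero] at h0
  have hz : s =ᵐ[S.weight] fun _ => 0 := eD.symm.trans (h0 ▸ Lp.coeFn_zero _ _ _)
  have h1 : S.SolvesWith (fun _ => 0) (fun _ => 0) (fun _ => 0) := by
    simpa using H.sin.const_mul 0
  have := (H.sin.eqOn_quasi h1 hz).2 S.left_mem
  rw [H.sin_quasi_a] at this
  exact one_ne_zero this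

/-- Shooting: the solution with zero data at `a` is corrected by the multiple of `s` that cancels
its value at `b`. -/
lemma IsFundamentalSystem.exists_dirichlet (H : S.IsFundamentalSystem z c c' s s')
    (hs : s S.b ≠ 0) (f : S.L2) : ∃ G : S.L2, (G, f + z • G) ∈ S.HDirichlet.graph := by
  obtain ⟨g₀, v₀, h₀, ga₀, va₀⟩ := H.exists_solvesWith (S.integrable_L2 f) 0 0
  have hg := h₀.add (H.sin.const_mul (-(g₀ S.b) / s S.b))
  obtain ⟨G, eG⟩ := S.exists_L2 hg.continuousOn
  refine ⟨G, mem_graph_HDirichlet_iff.2 ⟨_, _, hg.congr (fun _ _ => rfl) (fun _ _ => rfl)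
    ((graph_add_smul_ae eG z).trans (Filter.Eventually.of_forall fun x => ?_)), eG, ?_, ?_⟩⟩
  · simp only; ring
  · simp [ga₀, H.sin_a]
  · field_simp; ring

lemma IsFundamentalSystem.dirichlet_eq_zero (H : S.IsFundamentalSystem z c c' s s')
    (hs : s S.b ≠ 0) {G : S.L2} (hG : (G, z • G) ∈ S.HDirichlet.graph) : G = 0 := by
  obtain ⟨g, v, hg, eg, ga, gb⟩ := mem_graph_HDirichlet_iff.1 hG
  have hg' : S.SolvesWith g v fun x => z * g x :=
    hg.congr (fun _ _ => rfl) (fun _ _ => rfl) (by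
      filter_upwards [Lp.coeFn_smul z G, eg] with x e1 e2
      rw [e1, Pi.smul_apply, e2, smul_eq_mul])
  have hb := (H.eq_of_solvesWith_eigen hg' S.right_mem).1
  have va : v S.a = 0 := by simpa [ga, gb, hs] using hb.symm
  rw [Lp.eq_zero_iff_ae_eq_zero]
  filter_upwards [eg, S.ae_weight_mem] with x e hx
  rw [e, (H.eq_of_solvesWith_eigen hg' (Ioo_subset_Icc_self hx)).1, ga, va]
  simp

lemma HDirichlet_symmetric {f₁ h₁ f₂ h₂ : S.L2} (H₁ : (f₁, h₁) ∈ S.HDirichlet.graph)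
    (H₂ : (f₂, h₂) ∈ S.HDirichlet.graph) : inner ℂ h₁ f₂ = inner ℂ f₁ h₂ := by
  obtain ⟨g, v, hg, eg, ga, gb⟩ := mem_graph_HDirichlet_iff.1 H₁
  obtain ⟨w, y, hw, ew, wa, wb⟩ := mem_graph_HDirichlet_iff.1 H₂
  have := inner_sub_inner hg eg hw ew
  simpa [ga, gb, wa, wb, sub_eq_zero] using this

/-- A right inverse of an injective operator is a two-sided inverse. -/
lemma IsFundamentalSystem.isResolventAt_of_forall (H : S.IsFundamentalSystem z c c' s s')
    (hs : s S.b ≠ 0) {R : S.L2 →L[ℂ] S.L2}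
    (hR : ∀ f, (R f, f + z • R f) ∈ S.HDirichlet.graph) : IsResolventAt S.HDirichlet z R := by
  refine isResolventAt_iff.2 ⟨hR, fun g h hgh => ?_⟩
  refine sub_eq_zero.1 (H.dirichlet_eq_zero hs ?_)
  have := Submodule.sub_mem _ (hR (h - z • g)) hgh
  convert this using 1
  rw [Prod.mk_sub_mk]
  congr 1
  rw [smul_sub]
  abel

/-- The Dirichlet problem at `conj z` is solvable because `conj (s(b)) ≠ 0`, and symmetry identifies
its solution operator with the bounded operator adjoint to the resolvent at `z`. -/
lemma conj_mem_resolventSetOf_HDirichlet (hz : z ∈ resolventSetOf S.HDirichlet) :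
    conj z ∈ resolventSetOf S.HDirichlet := by
  obtain ⟨R, hR⟩ := hz
  obtain ⟨c, c', s, s', H⟩ := S.exists_isFundamentalSystem z
  have K := H.star_conj
  have hs : conj (s S.b) ≠ 0 := by simpa using H.sin_b_ne_zero hR
  refine ⟨ContinuousLinearMap.adjoint R, K.isResolventAt_of_forall hs fun f => ?_⟩
  obtain ⟨G, hG⟩ := K.exists_dirichlet hs f
  have : ContinuousLinearMap.adjoint R f = G := by
    refine ext_inner_right ℂ fun h => ?_
    rw [ContinuousLinearMap.adjoint_inner_left]
    have e := HDirichlet_symmetric hG ((isResolventAt_iff.1 hR).1 h)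
    rw [inner_add_left, inner_add_right, inner_smul_left, inner_smul_right, Complex.conj_conj] at e
    exact add_right_cancel e
  rw [this]
  exact hG

lemma IsFundamentalSystem.zero_mem_resolventSetOf (H : S.IsFundamentalSystem 0 c c' s s')
    (hs : s S.b ≠ 0) : (0 : ℂ) ∈ resolventSetOf S.HDirichlet := by
  have hex : ∀ f : S.L2, ∃ G : S.L2, (G, f) ∈ S.HDirichlet.graph := fun f => by
    simpa using H.exists_dirichlet hs f
  choose T hT using hex
  have huniq : ∀ {f G : S.L2}, (G, f) ∈ S.HDirichlet.graph → T f = G := fun {f G} hG => by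
    refine sub_eq_zero.1 (H.dirichlet_eq_zero hs ?_)
    simpa using Submodule.sub_mem _ (hT f) hG
  let L : S.L2 →ₗ[ℂ] S.L2 :=
    { toFun := T
      map_add' := fun f g => huniq (by simpa using Submodule.add_mem _ (hT f) (hT g))
      map_smul' := fun t f => huniq (by simpa using Submodule.smul_mem _ t (hT f)) }
  -- Boundedness comes from the Hellinger–Toeplitz theorem: the inverse is symmetric and defined
  -- everywhere.
  have hL : L.IsSymmetric := fun f g => (HDirichlet_symmetric (hT f) (hT g)).symm
  exact ⟨⟨L, hL.continuous⟩, H.isResolventAt_of_forall hs fun f => by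
    rw [zero_smul, add_zero]; exact hT f⟩

/-! ## The solutions with prescribed boundary values -/

lemma IsFundamentalSystem.exists_isBoundaryBasis (H : S.IsFundamentalSystem z c c' s s')
    (hs : s S.b ≠ 0) : ∃ u v, S.IsBoundaryBasis z u v := by
  refine ⟨![fun x => (1 / s S.b) * s x, fun x => c x - (c S.b / s S.b) * s x],
    ![fun x => (1 / s S.b) * s' x, fun x => c' x - (c S.b / s S.b) * s' x],
    Fin.forall_fin_two.2 ⟨isSolution_iff.2 ?_, isSolution_iff.2 ?_⟩, ?_, ?_, ?_, ?_⟩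
  · refine (H.sin.const_mul (1 / s S.b)).congr (fun _ _ => rfl) (fun _ _ => rfl)
      (Filter.Eventually.of_forall fun x => ?_)
    exact mul_left_comm _ _ _
  · refine (H.cos.sub (H.sin.const_mul (c S.b / s S.b))).congr (fun _ _ => rfl) (fun _ _ => rfl)
      (Filter.Eventually.of_forall fun x => ?_)
    change z * (c x - c S.b / s S.b * s x) = z * c x - c S.b / s S.b * (z * s x)
    ring
  · simp [H.sin_a]
  · simp [hs]
  · simp [H.sin_a, H.cos_a]
  · simp [hs]

namespace IsBoundaryBasis

variable {u v u₁ v₁ : Fin 2 → ℝ → ℂ}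

lemma solvesWith (B : S.IsBoundaryBasis z u v) (j : Fin 2) :
    S.SolvesWith (u j) (v j) fun x => z * u j x := isSolution_iff.1 (B.sol j)

/-- Solutions of `τ g = z g` are determined by their boundary values. -/
lemma eq_of_solvesWith (B : S.IsBoundaryBasis z u v) (H : S.IsFundamentalSystem z c c' s s')
    (hs : s S.b ≠ 0) {g w : ℝ → ℂ} (hg : S.SolvesWith g w fun x => z * g x) {x : ℝ}
    (hx : x ∈ Icc S.a S.b) :
    g x = g S.b * u 0 x + g S.a * u 1 x ∧ w x = g S.b * v 0 x + g S.a * v 1 x := by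
  have hd := hg.sub (((B.solvesWith 0).const_mul (g S.b)).add ((B.solvesWith 1).const_mul (g S.a)))
  have hd' := hd.congr (h₂ := fun x => z * (g x - (g S.b * u 0 x + g S.a * u 1 x)))
    (fun _ _ => rfl) (fun _ _ => rfl) (Filter.Eventually.of_forall fun x => by simp only; ring)
  have e := H.eq_of_solvesWith_eigen hd' hx
  have eb := (H.eq_of_solvesWith_eigen hd' S.right_mem).1
  simp only [B.fst_a, B.fst_b, B.snd_a, B.snd_b, mul_one, mul_zero, add_zero, zero_add, sub_self,
    zero_mul] at e eb
  rw [eq_comm, mul_eq_zero, or_iff_left hs] at eb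
  rw [eb, zero_mul, zero_mul] at e
  exact ⟨sub_eq_zero.1 e.1, sub_eq_zero.1 e.2⟩

lemma eqOn (B : S.IsBoundaryBasis z u v) (B₁ : S.IsBoundaryBasis z u₁ v₁)
    (H : S.IsFundamentalSystem z c c' s s') (hs : s S.b ≠ 0) (j : Fin 2) :
    EqOn (u j) (u₁ j) (Icc S.a S.b) ∧ EqOn (v j) (v₁ j) (Icc S.a S.b) := by
  have h := fun x hx => B₁.eq_of_solvesWith H hs (x := x) (B.solvesWith j) hx
  fin_cases j
  · simp only [Fin.zero_eta, B.fst_a, B.fst_b, one_mul, zero_mul, add_zero] at h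
    exact ⟨fun x hx => (h x hx).1, fun x hx => (h x hx).2⟩
  · simp only [Fin.mk_one, B.snd_a, B.snd_b, one_mul, zero_mul, zero_add] at h
    exact ⟨fun x hx => (h x hx).1, fun x hx => (h x hx).2⟩

lemma star_conj (B : S.IsBoundaryBasis z u v) :
    S.IsBoundaryBasis (conj z) (fun j x => conj (u j x)) (fun j x => conj (v j x)) := by
  refine ⟨fun j => isSolution_iff.2 ?_, by simp [B.fst_a], by simp [B.fst_b], by simp [B.snd_a],
    by simp [B.snd_b]⟩
  simpa using (B.solvesWith j).star_conj

end IsBoundaryBasis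

end SturmLiouville

lemma exists_inner_eq_one_of_notMem_span {H : Type*} [NormedAddCommGroup H]
    [InnerProductSpace ℂ H] {x y : H} (h : x ∉ Submodule.span ℂ {y}) :
    ∃ k : H, inner ℂ x k = 1 ∧ inner ℂ y k = 0 := by
  rw [← Submodule.orthogonal_orthogonal (Submodule.span ℂ {y}), Submodule.mem_orthogonal] at h
  push Not at h
  obtain ⟨u, hu, hne⟩ := h
  have hyu : inner ℂ y u = 0 :=
    (Submodule.mem_orthogonal _ _).1 hu y (Submodule.mem_span_singleton_self y)
  have hne' : inner ℂ x u ≠ 0 := fun h0 => hne (inner_eq_zero_symm.1 h0)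
  exact ⟨(inner ℂ x u)⁻¹ • u, by rw [inner_smul_right, inv_mul_cancel₀ hne'],
    by rw [inner_smul_right, hyu, mul_zero]⟩

namespace SturmLiouville

variable {S : SturmLiouville} {c c' s s' u : ℝ → ℂ}

/-! ## Strict positivity of the minimal operator excludes the Dirichlet eigenvalue zero -/

lemma integrable_L2_mul (l : S.L2) (hu : ContinuousOn u (Icc S.a S.b)) :
    Integrable (fun x => (l : ℝ → ℂ) x * u x) S.weight := by
  obtain ⟨C, hC⟩ := isCompact_Icc.exists_bound_of_continuousOn hu
  refine (S.integrable_L2 l).mul_bdd (c := C) ?_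
    (S.ae_weight_mem.mono fun x hx => hC x (Ioo_subset_Icc_self hx))
  exact (S.memLp_continuousOn hu).aestronglyMeasurable

/-- The functional `l ↦ ∫_(a, x] l u r dt`. -/
def moment (S : SturmLiouville) (u : ℝ → ℂ) (hu : ContinuousOn u (Icc S.a S.b)) (x : ℝ) :
    S.L2 →ₗ[ℂ] ℂ where
  toFun l := ∫ t in Ioc S.a x, (l : ℝ → ℂ) t * u t ∂S.weight
  map_add' l k := by
    rw [← integral_add (integrable_L2_mul l hu).integrableOn (integrable_L2_mul k hu).integrableOn]
    refine integral_congr_ae (ae_restrict_of_ae ?_)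
    filter_upwards [Lp.coeFn_add l k] with t ht
    rw [ht, Pi.add_apply, add_mul]
  map_smul' α l := by
    rw [RingHom.id_apply, smul_eq_mul, ← integral_const_mul]
    refine integral_congr_ae (ae_restrict_of_ae ?_)
    filter_upwards [Lp.coeFn_smul α l] with t ht
    rw [ht, Pi.smul_apply, smul_eq_mul, mul_assoc]

lemma moment_eq (hu : ContinuousOn u (Icc S.a S.b)) {x : ℝ} (hx : x ∈ Icc S.a S.b) (l : S.L2) :
    S.moment u hu x l = ∫ t in S.a..x, (S.r t : ℂ) * ((l : ℝ → ℂ) t * u t) :=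
  S.setIntegral_weight _ hx

lemma moment_b (hu : ContinuousOn u (Icc S.a S.b)) (l : S.L2) :
    S.moment u hu S.b l = ∫ t, (l : ℝ → ℂ) t * u t ∂S.weight := by
  rw [moment_eq hu S.right_mem, S.integral_weight]

/-- The bound on `F` is required only where `l` is nonzero, so that smallness near an endpoint
suffices for functions concentrated there. -/
lemma norm_setIntegral_mul_le (l : S.L2) {F : ℝ → ℂ} {η : ℝ}
    (h : ∀ᵐ x ∂S.weight, (l : ℝ → ℂ) x ≠ 0 → ‖F x‖ ≤ η) (hη : 0 ≤ η) (A : Set ℝ) :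
    ‖∫ x in A, (l : ℝ → ℂ) x * F x ∂S.weight‖ ≤ η * ∫ x, ‖(l : ℝ → ℂ) x‖ ∂S.weight := by
  have hi : Integrable (fun x => η * ‖(l : ℝ → ℂ) x‖) S.weight :=
    (S.integrable_L2 l).norm.const_mul η
  calc ‖∫ x in A, (l : ℝ → ℂ) x * F x ∂S.weight‖
      ≤ ∫ x in A, η * ‖(l : ℝ → ℂ) x‖ ∂S.weight := by
        refine norm_integral_le_of_norm_le hi.integrableOn (ae_restrict_of_ae ?_)
        filter_upwards [h] with x hx
        rw [norm_mul, mul_comm]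
        by_cases h0 : (l : ℝ → ℂ) x = 0
        · simp [h0]
        · exact mul_le_mul_of_nonneg_right (hx h0) (norm_nonneg _)
    _ ≤ ∫ x, η * ‖(l : ℝ → ℂ) x‖ ∂S.weight :=
        setIntegral_le_integral hi (Filter.Eventually.of_forall fun x => by positivity)
    _ = _ := integral_const_mul _ _

lemma norm_moment_le (hu : ContinuousOn u (Icc S.a S.b)) (l : S.L2) {η : ℝ}
    (h : ∀ᵐ x ∂S.weight, (l : ℝ → ℂ) x ≠ 0 → ‖u x‖ ≤ η) (hη : 0 ≤ η) (x : ℝ) :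
    ‖S.moment u hu x l‖ ≤ η * ∫ x, ‖(l : ℝ → ℂ) x‖ ∂S.weight :=
  norm_setIntegral_mul_le l h hη _

/-- Normalized indicator functions. -/
lemma exists_bump (S : SturmLiouville) {l m : ℝ} (hlm : l < m) (hal : S.a ≤ l) (hmb : m ≤ S.b) :
    ∃ X : S.L2, (∀ᵐ x ∂S.weight, (X : ℝ → ℂ) x ≠ 0 → x ∈ Ioo l m) ∧
      ∫ x, ‖(X : ℝ → ℂ) x‖ ∂S.weight = 1 ∧ ∫ x, (X : ℝ → ℂ) x ∂S.weight = 1 := by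
  have hμ : 0 < S.weight.real (Ioo l m) := by
    rw [measureReal_def, ENNReal.toReal_pos_iff]
    refine ⟨pos_iff_ne_zero.2 fun h0 => ?_, measure_lt_top _ _⟩
    have h1 : ∀ᵐ x ∂S.weight, x ∉ Ioo l m := by rwa [ae_iff, show {x | ¬ x ∉ Ioo l m} = Ioo l m by
      ext; simp]
    have h2 := S.ae_of_ae_weight h1
    rw [ae_restrict_iff' measurableSet_Ioo, ae_iff] at h2
    have h3 : volume (Ioo l m) = 0 := measure_mono_null (fun x hx => by
      simp only [mem_ofPred_eq, Classical.not_imp, not_not]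
      exact ⟨⟨hal.trans_lt hx.1, hx.2.trans_le hmb⟩, hx⟩) h2
    rw [Real.volume_Ioo, ENNReal.ofReal_eq_zero] at h3
    linarith
  set M : ℂ := (((S.weight.real (Ioo l m))⁻¹ : ℝ) : ℂ) with hM
  refine ⟨indicatorConstLp 2 measurableSet_Ioo (measure_ne_top S.weight (Ioo l m)) M, ?_, ?_, ?_⟩
  · filter_upwards [indicatorConstLp_coeFn (p := 2) (hs := measurableSet_Ioo)
      (hμs := measure_ne_top S.weight (Ioo l m)) (c := M)] with x hx h0
    by_contra hn
    exact h0 (by rw [hx, indicator_of_notMem hn])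
  · have : (fun x => ‖(indicatorConstLp 2 measurableSet_Ioo
        (measure_ne_top S.weight (Ioo l m)) M : ℝ → ℂ) x‖) =ᵐ[S.weight]
        (Ioo l m).indicator fun _ => ‖M‖ := by
      filter_upwards [indicatorConstLp_coeFn (p := 2) (hs := measurableSet_Ioo)
        (hμs := measure_ne_top S.weight (Ioo l m)) (c := M)] with x hx
      rw [hx, norm_indicator_eq_indicator_norm]
    rw [integral_congr_ae this, integral_indicator measurableSet_Ioo, setIntegral_const, hM,
      Complex.norm_real, Real.norm_of_nonneg (by positivity), smul_eq_mul, mul_inv_cancel₀ hμ.ne']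
  · rw [integral_congr_ae indicatorConstLp_coeFn, integral_indicator measurableSet_Ioo,
      setIntegral_const, hM, Complex.real_smul, ← Complex.ofReal_mul, mul_inv_cancel₀ hμ.ne',
      Complex.ofReal_one]

/-- A normalized bump averages `u` over `E`, so it acts as an approximate point evaluation. -/
lemma norm_moment_bump_sub_le (hu : ContinuousOn u (Icc S.a S.b)) {X : S.L2} {E : Set ℝ}
    (hX : ∀ᵐ x ∂S.weight, (X : ℝ → ℂ) x ≠ 0 → x ∈ E)
    (h1 : ∫ x, ‖(X : ℝ → ℂ) x‖ ∂S.weight = 1) (h2 : ∫ x, (X : ℝ → ℂ) x ∂S.weight = 1)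
    {L : ℂ} {η : ℝ} (hη : 0 ≤ η) (hE : ∀ x ∈ E, ‖u x - L‖ ≤ η) :
    ‖S.moment u hu S.b X - L‖ ≤ η := by
  have e : S.moment u hu S.b X - L = ∫ x in univ, (X : ℝ → ℂ) x * (u x - L) ∂S.weight := by
    simp only [Measure.restrict_univ, mul_sub]
    rw [integral_sub (integrable_L2_mul X hu) ((S.integrable_L2 X).mul_const L),
      integral_mul_const, h2, one_mul, moment_b]
  rw [e]
  have := norm_setIntegral_mul_le X (F := fun x => u x - L)
    (hX.mono fun x hx h0 => hE x (hx h0)) hη univ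
  rwa [h1, mul_one] at this

lemma moment_eq_zero (hu : ContinuousOn u (Icc S.a S.b)) {X : S.L2} {E : Set ℝ}
    (hX : ∀ᵐ x ∂S.weight, (X : ℝ → ℂ) x ≠ 0 → x ∈ E) {x : ℝ} (hx : ∀ t ∈ E, x < t) :
    S.moment u hu x X = 0 := by
  refine setIntegral_eq_zero_of_ae_eq_zero ?_
  filter_upwards [hX] with t ht htx
  have : (X : ℝ → ℂ) t = 0 := by
    by_contra h0
    exact (hx t (ht h0)).not_ge htx.2
  rw [this, zero_mul]

lemma moment_eq_moment_b (hu : ContinuousOn u (Icc S.a S.b)) {X : S.L2} {E : Set ℝ}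
    (hX : ∀ᵐ x ∂S.weight, (X : ℝ → ℂ) x ≠ 0 → x ∈ E) {x : ℝ} (hx : ∀ t ∈ E, t ≤ x) :
    S.moment u hu x X = S.moment u hu S.b X := by
  rw [moment_b]
  refine setIntegral_eq_integral_of_ae_compl_eq_zero ?_
  filter_upwards [hX, S.ae_weight_mem] with t ht hm htx
  have : (X : ℝ → ℂ) t = 0 := by
    by_contra h0
    exact htx ⟨hm.1, hx t (ht h0)⟩
  rw [this, zero_mul]

lemma moment_b_eq_inner (hu : ContinuousOn u (Icc S.a S.b))
    (hr : ∀ x ∈ Icc S.a S.b, conj (u x) = u x) {U : S.L2} (hU : U =ᵐ[S.weight] u) (l : S.L2) :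
    S.moment u hu S.b l = inner ℂ U l := by
  rw [moment_eq hu S.right_mem, S.inner_eq hU (ae_eq_refl _)]
  refine intervalIntegral.integral_congr fun x hx => ?_
  rw [uIcc_of_le S.hab.le] at hx
  simp only [hr x hx]
  ring

lemma exists_uniform_near (hu : ContinuousOn u (Icc S.a S.b)) {y : ℝ} (hy : y ∈ Icc S.a S.b)
    {η : ℝ} (hη : 0 < η) :
    ∃ δ > 0, ∀ x ∈ Icc S.a S.b, |x - y| < δ → ‖u x - u y‖ ≤ η := by
  obtain ⟨δ, hδ, h⟩ := Metric.continuousOn_iff.1 hu y hy η hη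
  exact ⟨δ, hδ, fun x hx hd => by
    rw [← dist_eq_norm]; exact (h x hx (by rwa [Real.dist_eq])).le⟩

namespace IsFundamentalSystem

/-- `c` and `s` are linearly independent in `L²`, because their data at `a` are. The dual vectors
serve to adjust the two moments independently. -/
lemma exists_dual (H : S.IsFundamentalSystem 0 c c' s s') : ∃ h₁ h₂ : S.L2,
    S.moment c H.cos.continuousOn S.b h₁ = 1 ∧ S.moment s H.sin.continuousOn S.b h₁ = 0 ∧
    S.moment c H.cos.continuousOn S.b h₂ = 0 ∧ S.moment s H.sin.continuousOn S.b h₂ = 1 := by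
  obtain ⟨rc, -, rs, -⟩ := H.conj_eqOn (map_zero _)
  obtain ⟨C, eC⟩ := S.exists_L2 H.cos.continuousOn
  obtain ⟨D, eD⟩ := S.exists_L2 H.sin.continuousOn
  simp only [moment_b_eq_inner _ rc eC, moment_b_eq_inner _ rs eD]
  have h1 : C ∉ Submodule.span ℂ {D} := by
    intro hm
    obtain ⟨t, ht⟩ := Submodule.mem_span_singleton.1 hm
    have : c =ᵐ[S.weight] fun x => t * s x := by
      filter_upwards [eC, eD, Lp.coeFn_smul t D] with x e1 e2 e3
      rw [← e1, ← ht, e3, Pi.smul_apply, e2, smul_eq_mul]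
    have := (H.cos.eqOn_quasi (H.sin.const_mul t) this).1 S.left_mem
    simp [H.cos_a, H.sin_a] at this
  have h2 : D ∉ Submodule.span ℂ {C} := by
    intro hm
    obtain ⟨t, ht⟩ := Submodule.mem_span_singleton.1 hm
    have : s =ᵐ[S.weight] fun x => t * c x := by
      filter_upwards [eD, eC, Lp.coeFn_smul t C] with x e1 e2 e3
      rw [← e1, ← ht, e3, Pi.smul_apply, e2, smul_eq_mul]
    have := (H.sin.eqOn_quasi (H.cos.const_mul t) this).2 S.left_mem
    simp [H.sin_quasi_a, H.cos_quasi_a] at this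
  obtain ⟨k₁, a1, a2⟩ := exists_inner_eq_one_of_notMem_span h1
  obtain ⟨k₂, b1, b2⟩ := exists_inner_eq_one_of_notMem_span h2
  exact ⟨k₁, k₂, a1, a2, b2, b1⟩

set_option maxHeartbeats 2000000 in
/-- A Dirichlet solution of `τ s = 0` is approximated in the sense of quadratic forms by elements
of the domain of the minimal operator. -/
lemma exists_form_approximation (H : S.IsFundamentalSystem 0 c c' s s') (hb : s S.b = 0)
    {D : S.L2} (eD : D =ᵐ[S.weight] s) :
    ∃ K : ℝ, 0 ≤ K ∧ ∀ η : ℝ, 0 < η → η ≤ 1 → ∃ f h : S.L2, (f, h) ∈ S.Hmin.graph ∧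
      ‖f - D‖ ≤ K * η ∧ ‖inner ℂ f h‖ ≤ K * η := by
  have hc := H.cos.continuousOn
  have hs := H.sin.continuousOn
  -- As `s(b) = 0`, the Wronskian at `b` reads `c(b) s^{[1]}(b) = 1`.
  have hcb : c S.b ≠ 0 := fun h0 => by simpa [h0, hb] using H.wronskian S.b S.right_mem
  obtain ⟨h₁, h₂, d1, d2, d3, d4⟩ := H.exists_dual
  obtain ⟨M₁, hM₁⟩ := isCompact_Icc.exists_bound_of_continuousOn hc
  obtain ⟨M₂, hM₂⟩ := isCompact_Icc.exists_bound_of_continuousOn hs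
  set M := max M₁ M₂
  have cM : ∀ x ∈ Icc S.a S.b, ‖c x‖ ≤ M := fun x hx => (hM₁ x hx).trans (le_max_left _ _)
  have sM : ∀ x ∈ Icc S.a S.b, ‖s x‖ ≤ M := fun x hx => (hM₂ x hx).trans (le_max_right _ _)
  have M0 : 0 ≤ M := (norm_nonneg _).trans (cM _ S.left_mem)
  obtain ⟨κ, hκ⟩ : ∃ κ, κ * c S.b = 1 := ⟨_, inv_mul_cancel₀ hcb⟩
  set N₁ := ∫ x, ‖(h₁ : ℝ → ℂ) x‖ ∂S.weight
  set N₂ := ∫ x, ‖(h₂ : ℝ → ℂ) x‖ ∂S.weight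
  have N₁0 : 0 ≤ N₁ := integral_nonneg fun x => norm_nonneg _
  have N₂0 : 0 ≤ N₂ := integral_nonneg fun x => norm_nonneg _
  clear_value M
  -- Multiplied by `η`, `d` bounds the coefficients `α`, `β` below, `KA` the partial `s`-moments of
  -- `h`, `KB` the deviation of its partial `c`-moments from `-1` away from the endpoints, and `K₁`
  -- the uniform distance from `f` to `s`.
  set d := 1 + ‖κ‖
  have d0 : 0 ≤ d := by positivity
  set KA := d * (1 + M * (N₁ + N₂))
  set KB := 1 + d * M + d * M * (N₁ + N₂)
  set K₁ := M * KA + (1 + M) * KB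
  have KA0 : 0 ≤ KA := by positivity
  have KB0 : 0 ≤ KB := by positivity
  have K₁0 : 0 ≤ K₁ := by positivity
  -- The square root of the total mass, which converts uniform bounds into `L²` bounds.
  set W : ℝ := (measureUnivNNReal S.weight : ℝ) ^ (ENNReal.toReal 2)⁻¹
  have W0 : 0 ≤ W := by positivity
  have hWle : ∀ (l : S.L2) (C : ℝ), 0 ≤ C → (∀ᵐ x ∂S.weight, ‖(l : ℝ → ℂ) x‖ ≤ C) →
      ‖l‖ ≤ W * C := fun l C hC hl => Lp.norm_le_of_ae_bound hC hl
  clear_value W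
  set K₂ := d * (K₁ + 1) + d * (‖h₁‖ + ‖h₂‖) * (‖D‖ + W * K₁)
  have K₂0 : 0 ≤ K₂ := by positivity
  refine ⟨W * K₁ + K₂, by positivity, fun η hη hη1 => ?_⟩
  obtain ⟨δ₁, p1, q1⟩ := exists_uniform_near hc S.left_mem hη
  obtain ⟨δ₂, p2, q2⟩ := exists_uniform_near hc S.right_mem hη
  obtain ⟨δ₃, p3, q3⟩ := exists_uniform_near hs S.left_mem hη
  obtain ⟨δ₄, p4, q4⟩ := exists_uniform_near hs S.right_mem hη
  have hab := S.hab
  obtain ⟨δ, hδ, l1, l2, l3, l4, l5⟩ : ∃ δ > 0, δ ≤ δ₁ ∧ δ ≤ δ₂ ∧ δ ≤ δ₃ ∧ δ ≤ δ₄ ∧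
      δ ≤ (S.b - S.a) / 2 := by
    refine ⟨min (min δ₁ δ₂) (min (min δ₃ δ₄) ((S.b - S.a) / 2)), ?_, ?_, ?_, ?_, ?_, ?_⟩
    · have : 0 < (S.b - S.a) / 2 := by linarith
      simp only [gt_iff_lt, lt_min_iff]
      exact ⟨⟨p1, p2⟩, ⟨p3, p4⟩, this⟩
    all_goals simp
  have ca : ∀ x ∈ Ioo S.a (S.a + δ), ‖c x - 1‖ ≤ η := fun x hx => by
    rw [← H.cos_a]
    exact q1 x ⟨hx.1.le, by linarith [hx.2]⟩ (by rw [abs_lt]; constructor <;> linarith [hx.1, hx.2])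
  have cb : ∀ x ∈ Ioo (S.b - δ) S.b, ‖c x - c S.b‖ ≤ η := fun x hx =>
    q2 x ⟨by linarith [hx.1], hx.2.le⟩ (by rw [abs_lt]; constructor <;> linarith [hx.1, hx.2])
  have sa : ∀ x ∈ Ioo S.a (S.a + δ), ‖s x‖ ≤ η := fun x hx => by
    have := q3 x ⟨hx.1.le, by linarith [hx.2]⟩
      (by rw [abs_lt]; constructor <;> linarith [hx.1, hx.2])
    rwa [H.sin_a, sub_zero] at this
  have sb : ∀ x ∈ Ioo (S.b - δ) S.b, ‖s x‖ ≤ η := fun x hx => by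
    have := q4 x ⟨by linarith [hx.1], hx.2.le⟩
      (by rw [abs_lt]; constructor <;> linarith [hx.1, hx.2])
    rwa [hb, sub_zero] at this
  obtain ⟨X, X1, X2, X3⟩ := S.exists_bump (l := S.a) (m := S.a + δ) (by linarith) le_rfl
    (by linarith)
  obtain ⟨Y, Y1, Y2, Y3⟩ := S.exists_bump (l := S.b - δ) (m := S.b) (by linarith) (by linarith)
    le_rfl
  set mc := fun x => S.moment c hc x
  set ms := fun x => S.moment s hs x
  -- `α` and `β` are minus the `c`- and `s`-moments of `-X + κ Y`. They are of order `η` because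
  -- `c(a) = κ c(b) = 1` and `s(a) = s(b) = 0`.
  obtain ⟨α, hαd⟩ : ∃ α, α = mc S.b X - κ * mc S.b Y := ⟨_, rfl⟩
  obtain ⟨β, hβd⟩ : ∃ β, β = ms S.b X - κ * ms S.b Y := ⟨_, rfl⟩
  have hα : ‖α‖ ≤ d * η := by
    have e : α = (mc S.b X - 1) - κ * (mc S.b Y - c S.b) := by
      linear_combination hαd - hκ
    rw [e]
    refine (norm_sub_le _ _).trans ?_
    rw [norm_mul]
    have h1 := norm_moment_bump_sub_le hc X1 X2 X3 hη.le ca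
    have h2 := norm_moment_bump_sub_le hc Y1 Y2 Y3 hη.le cb
    calc _ ≤ η + ‖κ‖ * η := by gcongr
      _ = _ := by ring
  have hβ : ‖β‖ ≤ d * η := by
    have e : β = (ms S.b X - 0) - κ * (ms S.b Y - 0) := by rw [sub_zero, sub_zero, hβd]
    rw [e]
    refine (norm_sub_le _ _).trans ?_
    rw [norm_mul]
    have h1 := norm_moment_bump_sub_le hs X1 X2 X3 (L := 0) hη.le (by simpa using sa)
    have h2 := norm_moment_bump_sub_le hs Y1 Y2 Y3 (L := 0) hη.le (by simpa using sb)
    calc _ ≤ η + ‖κ‖ * η := by gcongr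
      _ = _ := by ring
  -- Heuristically `h` is `-δ_a + c(b)⁻¹ δ_b`. In the interior its partial `s`-moment is about `0`
  -- and its partial `c`-moment about `-1`, so Duhamel's formula returns about `s`. The small
  -- correction by `h₁`, `h₂` makes both full moments vanish, which puts the preimage in the domain
  -- of `Hmin`.
  obtain ⟨h, hh⟩ : ∃ h : S.L2, h = -X + κ • Y + α • h₁ + β • h₂ := ⟨_, rfl⟩
  have expand : ∀ φ : S.L2 →ₗ[ℂ] ℂ, φ h = -φ X + κ * φ Y + α * φ h₁ + β * φ h₂ := fun φ => by
    simp [hh, map_add, map_neg, map_smul]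
  have mch : mc S.b h = 0 := by
    rw [expand (mc S.b)]
    simp only [mc, d1, d3] at hαd ⊢; rw [hαd]; ring
  have msh : ms S.b h = 0 := by
    rw [expand (ms S.b)]
    simp only [ms, d2, d4] at hβd ⊢; rw [hβd]; ring
  obtain ⟨f, hf, ef⟩ := H.exists_Hmin (h := h)
    ((moment_eq hc S.right_mem h).symm.trans mch) ((moment_eq hs S.right_mem h).symm.trans msh)
  specialize ef (fun x => c x * ms x h - s x * mc x h) fun x hx => by
    simp only [mc, ms, moment_eq hc hx, moment_eq hs hx]
  -- Both bumps live where `‖s‖ ≤ η`, and the correction has coefficients of order `η`.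
  have bA : ∀ x, ‖ms x h‖ ≤ KA * η := fun x => by
    rw [expand (ms x)]
    have t1 : ‖ms x X‖ ≤ η * 1 := X2 ▸ norm_moment_le hs X (X1.mono fun t ht h0 => sa t (ht h0))
      hη.le x
    have t2 : ‖ms x Y‖ ≤ η * 1 := Y2 ▸ norm_moment_le hs Y (Y1.mono fun t ht h0 => sb t (ht h0))
      hη.le x
    have t3 : ‖ms x h₁‖ ≤ M * N₁ := norm_moment_le hs h₁ (S.ae_weight_mem.mono fun t ht _ =>
      sM t (Ioo_subset_Icc_self ht)) M0 x
    have t4 : ‖ms x h₂‖ ≤ M * N₂ := norm_moment_le hs h₂ (S.ae_weight_mem.mono fun t ht _ =>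
      sM t (Ioo_subset_Icc_self ht)) M0 x
    calc _ ≤ ‖ms x X‖ + ‖κ‖ * ‖ms x Y‖ + ‖α‖ * ‖ms x h₁‖ + ‖β‖ * ‖ms x h₂‖ := by
          refine (norm_add_le _ _).trans ?_
          rw [norm_mul]
          refine add_le_add_left ((norm_add_le _ _).trans ?_) _
          rw [norm_mul]
          refine add_le_add_left ((norm_add_le _ _).trans ?_) _
          rw [norm_mul, norm_neg]
      _ ≤ η * 1 + ‖κ‖ * (η * 1) + (d * η) * (M * N₁) + (d * η) * (M * N₂) := by gcongr
      _ = _ := by simp only [KA, d]; ring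
  have rest : ∀ x, ‖α * mc x h₁ + β * mc x h₂‖ ≤ d * M * (N₁ + N₂) * η := fun x => by
    have t3 : ‖mc x h₁‖ ≤ M * N₁ := norm_moment_le hc h₁ (S.ae_weight_mem.mono fun t ht _ =>
      cM t (Ioo_subset_Icc_self ht)) M0 x
    have t4 : ‖mc x h₂‖ ≤ M * N₂ := norm_moment_le hc h₂ (S.ae_weight_mem.mono fun t ht _ =>
      cM t (Ioo_subset_Icc_self ht)) M0 x
    refine (norm_add_le _ _).trans ?_
    rw [norm_mul, norm_mul]
    calc _ ≤ (d * η) * (M * N₁) + (d * η) * (M * N₂) := by gcongr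
      _ = _ := by ring
  -- A crude bound without the factor `η`, enough near the endpoints, where `s` itself supplies that
  -- factor.
  have bBe : ∀ x, ‖mc x h + 1‖ ≤ KB := fun x => by
    rw [expand (mc x)]
    have t1 : ‖mc x X‖ ≤ M * 1 := X2 ▸ norm_moment_le hc X (S.ae_weight_mem.mono fun t ht _ =>
      cM t (Ioo_subset_Icc_self ht)) M0 x
    have t2 : ‖mc x Y‖ ≤ M * 1 := Y2 ▸ norm_moment_le hc Y (S.ae_weight_mem.mono fun t ht _ =>
      cM t (Ioo_subset_Icc_self ht)) M0 x
    have e : -mc x X + κ * mc x Y + α * mc x h₁ + β * mc x h₂ + 1 =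
        1 + (-mc x X + κ * mc x Y) + (α * mc x h₁ + β * mc x h₂) := by ring
    rw [e]
    refine (norm_add₃_le).trans ?_
    have t5 : ‖-mc x X + κ * mc x Y‖ ≤ d * M := by
      refine (norm_add_le _ _).trans ?_
      rw [norm_neg, norm_mul]
      calc _ ≤ M * 1 + ‖κ‖ * (M * 1) := by gcongr
        _ = _ := by simp only [d]; ring
    have t6 : d * M * (N₁ + N₂) * η ≤ d * M * (N₁ + N₂) * 1 := by gcongr
    rw [norm_one]
    simp only [KB]
    linarith [rest x]
  -- Between the bumps, `X` has been integrated completely and `Y` not at all.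
  have bBm : ∀ x, S.a + δ ≤ x → x ≤ S.b - δ → ‖mc x h + 1‖ ≤ KB * η := fun x hx1 hx2 => by
    rw [expand (mc x)]
    have t1 : mc x X = mc S.b X := moment_eq_moment_b hc X1 fun t ht => by linarith [ht.2]
    have t2 : mc x Y = 0 := moment_eq_zero hc Y1 fun t ht => by linarith [ht.1]
    have e : -mc x X + κ * mc x Y + α * mc x h₁ + β * mc x h₂ + 1 =
        -(mc S.b X - 1) + (α * mc x h₁ + β * mc x h₂) := by rw [t1, t2]; ring
    rw [e]
    refine (norm_add_le _ _).trans ?_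
    rw [norm_neg]
    have t3 := norm_moment_bump_sub_le hc X1 X2 X3 hη.le ca
    have t4 : 0 ≤ d * M * η := by positivity
    calc _ ≤ η + d * M * (N₁ + N₂) * η := add_le_add t3 (rest x)
      _ ≤ _ := by simp only [KB]; nlinarith
  have near : ∀ x ∈ Ioo S.a S.b, ‖(c x * ms x h - s x * mc x h) - s x‖ ≤ K₁ * η := fun x hx => by
    have hx' := Ioo_subset_Icc_self hx
    have e : (c x * ms x h - s x * mc x h) - s x = c x * ms x h - s x * (mc x h + 1) := by ring
    rw [e]
    refine (norm_sub_le _ _).trans ?_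
    rw [norm_mul, norm_mul]
    have t1 : ‖c x‖ * ‖ms x h‖ ≤ M * (KA * η) := by
      gcongr
      exacts [cM x hx', bA x]
    have t2 : ‖s x‖ * ‖mc x h + 1‖ ≤ (1 + M) * KB * η := by
      have hend : ‖s x‖ ≤ η → ‖s x‖ * ‖mc x h + 1‖ ≤ (1 + M) * KB * η := fun hsx => by
        calc _ ≤ η * KB := by
              gcongr
              exact bBe x
          _ ≤ _ := by nlinarith [mul_nonneg (mul_nonneg M0 KB0) hη.le]
      rcases lt_or_ge x (S.a + δ) with h1 | h1
      · exact hend (sa x ⟨hx.1, h1⟩)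
      rcases lt_or_ge (S.b - δ) x with h2 | h2
      · exact hend (sb x ⟨h2, hx.2⟩)
      calc _ ≤ M * (KB * η) := by
            gcongr
            exacts [sM x hx', bBm x h1 h2]
        _ ≤ _ := by nlinarith [mul_nonneg KB0 hη.le]
    calc _ ≤ M * (KA * η) + (1 + M) * KB * η := add_le_add t1 t2
      _ = _ := by simp only [K₁]; ring
  have hfD : ‖f - D‖ ≤ W * (K₁ * η) := by
    refine hWle _ _ (by positivity) ?_
    filter_upwards [Lp.coeFn_sub f D, ef, eD, S.ae_weight_mem] with x e1 e2 e3 hx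
    rw [e1, Pi.sub_apply, e2, e3]
    exact near x hx
  have hfn : ‖f‖ ≤ ‖D‖ + W * K₁ := by
    have : ‖f‖ ≤ ‖D‖ + ‖f - D‖ := by
      calc ‖f‖ = ‖D + (f - D)‖ := by rw [add_sub_cancel]
        _ ≤ _ := norm_add_le _ _
    have t : W * (K₁ * η) ≤ W * (K₁ * 1) := by gcongr
    linarith
  -- On the support of a bump `s` is small, and `f` is uniformly close to `s`. Thus the pairing is
  -- small although the `L²` norms of the bumps are not controlled.
  have hbump : ∀ (Z : S.L2) (E : Set ℝ), (∀ᵐ x ∂S.weight, (Z : ℝ → ℂ) x ≠ 0 → x ∈ E) →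
      ∫ x, ‖(Z : ℝ → ℂ) x‖ ∂S.weight = 1 → (∀ x ∈ E, ‖s x‖ ≤ η) →
      ‖inner ℂ f Z‖ ≤ (K₁ + 1) * η := by
    intro Z E hZ hZ1 hE
    have e : inner ℂ f Z = ∫ x in univ, (Z : ℝ → ℂ) x * conj ((f : ℝ → ℂ) x) ∂S.weight := by
      rw [Measure.restrict_univ, L2.inner_def]
      rfl
    rw [e]
    refine (norm_setIntegral_mul_le Z (η := (K₁ + 1) * η) ?_ (by positivity) univ).trans_eq (by rw [hZ1, mul_one])
    filter_upwards [hZ, ef, S.ae_weight_mem] with x hx e2 hm h0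
    rw [RCLike.norm_conj, e2]
    calc _ = ‖((c x * ms x h - s x * mc x h) - s x) + s x‖ := by rw [sub_add_cancel]
      _ ≤ K₁ * η + η := (norm_add_le _ _).trans (add_le_add (near x hm) (hE x (hx h0)))
      _ = _ := by ring
  refine ⟨f, h, hf, hfD.trans ?_, ?_⟩
  · linarith [add_mul (W * K₁) K₂ η, mul_assoc W K₁ η, mul_nonneg K₂0 hη.le]
  · have e := expand (innerₛₗ ℂ f)
    simp only [innerₛₗ_apply_apply] at e
    rw [e]
    have t1 := hbump X _ X1 X2 sa
    have t2 := hbump Y _ Y1 Y2 sb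
    have t3 : ‖inner ℂ f h₁‖ ≤ (‖D‖ + W * K₁) * ‖h₁‖ := (norm_inner_le_norm _ _).trans (by gcongr)
    have t4 : ‖inner ℂ f h₂‖ ≤ (‖D‖ + W * K₁) * ‖h₂‖ := (norm_inner_le_norm _ _).trans (by gcongr)
    have hWK : 0 ≤ W * K₁ * η := by positivity
    calc _ ≤ ‖inner ℂ f X‖ + ‖κ‖ * ‖inner ℂ f Y‖ + ‖α‖ * ‖inner ℂ f h₁‖ +
            ‖β‖ * ‖inner ℂ f h₂‖ := by
          refine (norm_add_le _ _).trans ?_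
          rw [norm_mul]
          refine add_le_add_left ((norm_add_le _ _).trans ?_) _
          rw [norm_mul]
          refine add_le_add_left ((norm_add_le _ _).trans ?_) _
          rw [norm_mul, norm_neg]
      _ ≤ (K₁ + 1) * η + ‖κ‖ * ((K₁ + 1) * η) + (d * η) * ((‖D‖ + W * K₁) * ‖h₁‖) +
            (d * η) * ((‖D‖ + W * K₁) * ‖h₂‖) := by gcongr
      _ = K₂ * η := by simp only [K₂, d]; ring
      _ ≤ (W * K₁ + K₂) * η := by linarith [add_mul (W * K₁) K₂ η]

/-- If `s(b) = 0`, positivity applied to the approximants gives `ε ‖f‖² ≤ K η`, while `f` tends to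
`s` in `L²`. So `s` would vanish, contrary to `s^{[1]}(a) = 1`. -/
lemma sin_b_ne_zero_of_strictlyPositive (H : S.IsFundamentalSystem 0 c c' s s')
    (hpos : StrictlyPositive S.Hmin) : s S.b ≠ 0 := by
  intro hb
  obtain ⟨ε, hε, hform⟩ := hpos
  obtain ⟨D, eD⟩ := S.exists_L2 H.sin.continuousOn
  obtain ⟨K, K0, happ⟩ := H.exists_form_approximation hb eD
  have hD : ‖D‖ ^ 2 ≤ 0 := by
    have hle : ∀ η : ℝ, 0 < η → η ≤ 1 → ‖D‖ ^ 2 ≤ (2 * K / ε + 2 * K ^ 2) * η := by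
      intro η hη hη1
      obtain ⟨f, h, hfh, h1, h2⟩ := happ η hη hη1
      obtain ⟨y, rfl, rfl⟩ := (LinearPMap.mem_graph_iff _).1 hfh
      have h3 := hform y
      have h4 : ε * ‖(y : S.L2)‖ ^ 2 ≤ K * η := h3.trans ((Complex.re_le_norm _).trans h2)
      have h5 : ‖(y : S.L2)‖ ^ 2 ≤ K * η / ε := by rw [le_div_iff₀ hε]; linarith
      have h6 : ‖D‖ ≤ ‖(y : S.L2)‖ + K * η := by
        calc ‖D‖ = ‖(y : S.L2) - ((y : S.L2) - D)‖ := by rw [sub_sub_cancel]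
          _ ≤ _ := (norm_sub_le _ _).trans (by gcongr)
      have h7 : ‖D‖ ^ 2 ≤ 2 * ‖(y : S.L2)‖ ^ 2 + 2 * (K * η) ^ 2 := by
        have : ‖D‖ ^ 2 ≤ (‖(y : S.L2)‖ + K * η) ^ 2 := by gcongr
        nlinarith [sq_nonneg (‖(y : S.L2)‖ - K * η)]
      have h8 : (K * η) ^ 2 ≤ K ^ 2 * η := by
        rw [mul_pow]
        gcongr
        nlinarith
      calc ‖D‖ ^ 2 ≤ 2 * (K * η / ε) + 2 * (K ^ 2 * η) := by linarith
        _ = _ := by ring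
    have ht : Filter.Tendsto (fun η : ℝ => (2 * K / ε + 2 * K ^ 2) * η)
        (nhdsWithin 0 (Ioi 0)) (nhds 0) := by
      have : Continuous fun η : ℝ => (2 * K / ε + 2 * K ^ 2) * η := by fun_prop
      simpa using (this.tendsto 0).mono_left nhdsWithin_le_nhds
    refine ge_of_tendsto ht ?_
    filter_upwards [Ioo_mem_nhdsGT (zero_lt_one' ℝ)] with η hη
    exact hle η hη.1 hη.2.le
  have hD0 : D = 0 := by
    have : ‖D‖ = 0 := by nlinarith [norm_nonneg D]
    exact norm_eq_zero.1 this
  have hz : s =ᵐ[S.weight] fun _ => 0 := eD.symm.trans (hD0 ▸ Lp.coeFn_zero _ _ _)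
  have h1 : S.SolvesWith (fun _ => 0) (fun _ => 0) (fun _ => 0) := by
    simpa using H.sin.const_mul 0
  have := (H.sin.eqOn_quasi h1 hz).2 S.left_mem
  rw [H.sin_quasi_a] at this
  exact one_ne_zero this

end IsFundamentalSystem

end SturmLiouville

namespace SturmLiouville

variable {S : SturmLiouville} {z : ℂ} {c c' s s' : ℝ → ℂ} {u v y w : Fin 2 → ℝ → ℂ}

/-! ## The Krein-von Neumann extension -/

/-- The boundary condition of the Krein-von Neumann extension. -/
def KreinCondition (S : SturmLiouville) (v : Fin 2 → ℝ → ℂ) (g w : ℝ → ℂ) : Prop :=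
  w S.a = g S.b * v 0 S.a + g S.a * v 1 S.a ∧ w S.b = g S.b * v 0 S.b + g S.a * v 1 S.b

/-- The matrix `Q_{F_K, 0}(z)` in terms of the quasi-derivatives at `0` and at `z`. -/
def kreinResolventMatrix (S : SturmLiouville) (v y : Fin 2 → ℝ → ℂ) : Matrix (Fin 2) (Fin 2) ℂ :=
  !![v 0 S.b - y 0 S.b, -v 0 S.a - y 1 S.b; -v 0 S.a + y 0 S.a, -v 1 S.a + y 1 S.a]

lemma Hmin_le_adjoint (S : SturmLiouville) : S.Hmin ≤ S.Hmin.adjoint := by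
  rw [adjoint_Hmin]
  apply LinearPMap.le_of_le_graph
  rintro ⟨f, h⟩ hfh
  obtain ⟨g, w, hg, e, -⟩ := mem_graph_Hmin_iff.1 hfh
  exact mem_graph_Hmax_iff.2 ⟨g, w, hg, e⟩

/-- `domRestrict` intersects with the domain of the adjoint; nothing is lost, since both summands
lie in it. -/
lemma domain_HKrein (S : SturmLiouville) :
    S.HKrein.domain = S.Hmin.domain ⊔ operatorKer S.Hmin.adjoint := by
  rw [HKrein, kreinVonNeumann, LinearPMap.domRestrict_domain, inf_eq_left]
  refine sup_le S.Hmin_le_adjoint.1 fun f hf => ?_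
  exact LinearPMap.mem_domain_of_mem_graph (mem_operatorKer_iff.1 hf)

lemma mem_graph_HKrein_iff {f h : S.L2} : (f, h) ∈ S.HKrein.graph ↔
    f ∈ S.HKrein.domain ∧ (f, h) ∈ S.Hmax.graph := by
  have hle : S.HKrein ≤ S.Hmax := by
    rw [← adjoint_Hmin]; exact LinearPMap.domRestrict_le
  constructor
  · exact fun H => ⟨LinearPMap.mem_domain_of_mem_graph H, LinearPMap.le_graph_of_le hle H⟩
  · rintro ⟨hd, hm⟩
    obtain ⟨k, hk⟩ := LinearPMap.mem_domain_iff.1 hd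
    rwa [S.Hmax.mem_graph_snd_inj hm (LinearPMap.le_graph_of_le hle hk) rfl]

lemma Hmin_le_HKrein (S : SturmLiouville) : S.Hmin ≤ S.HKrein := by
  apply LinearPMap.le_of_le_graph
  rintro ⟨f, h⟩ hfh
  refine mem_graph_HKrein_iff.2 ⟨?_, ?_⟩
  · rw [domain_HKrein]
    exact Submodule.mem_sup_left (LinearPMap.mem_domain_of_mem_graph hfh)
  · rw [← adjoint_Hmin]
    exact LinearPMap.le_graph_of_le S.Hmin_le_adjoint hfh

namespace IsBoundaryBasis

lemma solvesWith_zero (B : S.IsBoundaryBasis 0 u v) (j : Fin 2) :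
    S.SolvesWith (u j) (v j) fun _ => 0 := by
  simpa using B.solvesWith j

/-- The prescribed values `0` and `1` are real, so conjugating the basis at `conj z` gives the one
at `z`. -/
lemma conj_eqOn (B : S.IsBoundaryBasis z u v) {u' v' : Fin 2 → ℝ → ℂ}
    (B' : S.IsBoundaryBasis (conj z) u' v') (H : S.IsFundamentalSystem z c c' s s')
    (hs : s S.b ≠ 0) (j : Fin 2) {x : ℝ} (hx : x ∈ Icc S.a S.b) :
    conj (u' j x) = u j x ∧ conj (v' j x) = v j x := by
  have K := B'.star_conj
  rw [Complex.conj_conj] at K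
  exact ⟨(K.eqOn B H hs j).1 hx, (K.eqOn B H hs j).2 hx⟩

/-- The two sides are the values at `b` and at `a` of the constant Wronskian of `u₁`, `u₂`. -/
lemma wronskian (B : S.IsBoundaryBasis z u v) : v 1 S.b = -v 0 S.a := by
  have h := ((B.solvesWith 0).lagrange (B.solvesWith 1)).eqOn_const
    (Filter.Eventually.of_forall fun t => by simp; right; ring) S.b S.right_mem
  simpa [B.fst_a, B.fst_b, B.snd_a, B.snd_b] using h

lemma exists_L2_combination (B : S.IsBoundaryBasis z u v) (α β : ℂ) : ∃ N : S.L2,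
    N =ᵐ[S.weight] fun x => α * u 0 x + β * u 1 x :=
  S.exists_L2 (((B.solvesWith 0).const_mul α).add ((B.solvesWith 1).const_mul β)).continuousOn

/-- Elements of the kernel are the combinations `g(b) u₁ + g(a) u₂`, for which the condition is an
identity; elements of the domain of `Hmin` have zero boundary data. Conversely, the condition says
precisely that subtracting this combination removes all four boundary values. -/
lemma mem_HKrein_domain_iff (B : S.IsBoundaryBasis 0 u v) (H : S.IsFundamentalSystem 0 c c' s s')
    (hs : s S.b ≠ 0) {g w : ℝ → ℂ} {f h : S.L2} (hg : S.SolvesWith g w h)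
    (e : f =ᵐ[S.weight] g) : f ∈ S.HKrein.domain ↔ KreinCondition S v g w := by
  rw [domain_HKrein]
  constructor
  · intro hf
    obtain ⟨k, hk, n, hn, hkn⟩ := Submodule.mem_sup.1 hf
    obtain ⟨l, hl⟩ := LinearPMap.mem_domain_iff.1 hk
    obtain ⟨g₁, w₁, h₁, e₁, a1, a2, a3, a4⟩ := mem_graph_Hmin_iff.1 hl
    obtain ⟨g₂, w₂, h₂, e₂⟩ := mem_operatorKer_adjoint_iff.1 hn
    have he : g =ᵐ[S.weight] fun x => g₁ x + g₂ x := by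
      filter_upwards [e, e₁, e₂, Lp.coeFn_add k n] with x x1 x2 x3 x4
      rw [← x1, ← hkn, x4, Pi.add_apply, x2, x3]
    obtain ⟨eg, ew⟩ := hg.eqOn_quasi (h₁.add h₂) he
    have key := fun x hx => (B.eq_of_solvesWith H hs (g := g₂) (w := w₂) (by simpa using h₂)
      (x := x) hx).2
    have ga := eg S.left_mem
    have gb := eg S.right_mem
    have wa := ew S.left_mem
    have wb := ew S.right_mem
    simp only [a1, a2, a3, a4, zero_add] at ga gb wa wb
    exact ⟨by rw [wa, ga, gb, key _ S.left_mem], by rw [wb, ga, gb, key _ S.right_mem]⟩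
  · rintro ⟨ha, hb⟩
    obtain ⟨N, eN⟩ := B.exists_L2_combination (g S.b) (g S.a)
    have hN := ((B.solvesWith_zero 0).const_mul (g S.b)).add
      ((B.solvesWith_zero 1).const_mul (g S.a))
    simp only [mul_zero, add_zero] at hN
    have hmem : N ∈ operatorKer S.Hmin.adjoint :=
      mem_operatorKer_adjoint_iff.2 ⟨_, _, hN, eN⟩
    have hmin : (f - N, h) ∈ S.Hmin.graph := by
      refine mem_graph_Hmin_iff.2 ⟨_, _, (hg.sub hN).congr (fun _ _ => rfl) (fun _ _ => rfl)
        (Filter.Eventually.of_forall fun x => by simp), ?_, ?_, ?_, ?_, ?_⟩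
      · filter_upwards [Lp.coeFn_sub f N, e, eN] with x x1 x2 x3
        rw [x1, Pi.sub_apply, x2, x3]
      · simp [B.fst_a, B.snd_a]
      · simp only [ha, sub_self]
      · simp [B.fst_b, B.snd_b]
      · simp only [hb, sub_self]
    rw [← sub_add_cancel f N]
    exact Submodule.add_mem_sup (LinearPMap.mem_domain_of_mem_graph hmin) hmem

lemma mem_graph_HKrein_iff (B : S.IsBoundaryBasis 0 u v) (H : S.IsFundamentalSystem 0 c c' s s')
    (hs : s S.b ≠ 0) {f h : S.L2} : (f, h) ∈ S.HKrein.graph ↔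
      ∃ g w, S.SolvesWith g w h ∧ f =ᵐ[S.weight] g ∧ KreinCondition S v g w := by
  rw [SturmLiouville.mem_graph_HKrein_iff, mem_graph_Hmax_iff]
  constructor
  · rintro ⟨hd, g, w, hg, e⟩
    exact ⟨g, w, hg, e, (B.mem_HKrein_domain_iff H hs hg e).1 hd⟩
  · rintro ⟨g, w, hg, e, hk⟩
    exact ⟨(B.mem_HKrein_domain_iff H hs hg e).2 hk, g, w, hg, e⟩

lemma disjoint_domain_ker (B : S.IsBoundaryBasis 0 u v) (H : S.IsFundamentalSystem 0 c c' s s')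
    (hs : s S.b ≠ 0) : Disjoint S.Hmin.domain (operatorKer S.Hmin.adjoint) := by
  rw [Submodule.disjoint_def]
  intro f hf hk
  obtain ⟨l, hl⟩ := LinearPMap.mem_domain_iff.1 hf
  obtain ⟨g₁, w₁, h₁, e₁, a1, a2, a3, a4⟩ := mem_graph_Hmin_iff.1 hl
  obtain ⟨g₂, w₂, h₂, e₂⟩ := mem_operatorKer_adjoint_iff.1 hk
  obtain ⟨eg, -⟩ := h₁.eqOn_quasi h₂ (e₁.symm.trans e₂)
  rw [Lp.eq_zero_iff_ae_eq_zero]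
  filter_upwards [e₂, S.ae_weight_mem] with x x1 hx
  rw [x1, (B.eq_of_solvesWith H hs (g := g₂) (w := w₂) (by simpa using h₂)
    (Ioo_subset_Icc_self hx)).1, ← eg S.left_mem, ← eg S.right_mem, a1, a3]
  simp

/-- As `u₁(a) = 0`, one has `u₁ = u₁^{[1]}(a) s`, and `u₁(b) = 1`. -/
lemma quasi_a_ne_zero (B : S.IsBoundaryBasis z u v) (H : S.IsFundamentalSystem z c c' s s') :
    v 0 S.a ≠ 0 := by
  intro h0
  have := (H.eq_of_solvesWith_eigen (B.solvesWith 0) S.right_mem).1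
  rw [B.fst_a, h0, B.fst_b] at this
  simp at this

/-- The Krein condition has real coefficients, and the Wronskian relation makes the boundary form
vanish between any two functions satisfying it. Conversely, pairing an element of the adjoint with
`u₁` and `u₂` recovers the two conditions. -/
lemma isSelfAdjoint_HKrein (B : S.IsBoundaryBasis 0 u v) (H : S.IsFundamentalSystem 0 c c' s s')
    (hs : s S.b ≠ 0) : IsSelfAdjoint S.HKrein := by
  rw [LinearPMap.isSelfAdjoint_def]
  apply LinearPMap.eq_of_eq_graph
  have hd : Dense (S.HKrein.domain : Set S.L2) := S.dense_Hmin.mono S.Hmin_le_HKrein.1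
  have hw := B.wronskian
  have hr := fun j x (hx : x ∈ Icc S.a S.b) =>
    (B.conj_eqOn (by rwa [map_zero]) H hs j hx).2
  have r0a := hr 0 _ S.left_mem
  have r1a := hr 1 _ S.left_mem
  have r0b := hr 0 _ S.right_mem
  have r1b := hr 1 _ S.right_mem
  rw [LinearPMap.adjoint_graph_eq_graph_adjoint hd]
  ext ⟨f, h⟩
  rw [Submodule.mem_adjoint_iff]
  constructor
  · intro K
    have hm : (f, h) ∈ S.Hmax.graph := mem_graph_Hmax_of_formalAdjoint fun k l hkl =>
      sub_eq_zero.1 (K k l (LinearPMap.le_graph_of_le S.Hmin_le_HKrein hkl))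
    obtain ⟨g, w, hg, e⟩ := mem_graph_Hmax_iff.1 hm
    refine (B.mem_graph_HKrein_iff H hs).2 ⟨g, w, hg, e, ?_⟩
    have test : ∀ j, (conj (u j S.b) * w S.b - conj (v j S.b) * g S.b) -
        (conj (u j S.a) * w S.a - conj (v j S.a) * g S.a) = 0 := by
      intro j
      obtain ⟨U, eU⟩ := S.exists_L2 (B.solvesWith j).continuousOn
      have hU : S.SolvesWith (u j) (v j) (0 : S.L2) := (B.solvesWith_zero j).congr
        (fun _ _ => rfl) (fun _ _ => rfl) (Lp.coeFn_zero _ _ _)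
      rw [← inner_sub_inner hU eU hg e]
      refine K U 0 ((B.mem_graph_HKrein_iff H hs).2 ⟨_, _, hU, eU, ?_⟩)
      fin_cases j
      · simp [KreinCondition, B.fst_a, B.fst_b]
      · simp [KreinCondition, B.snd_a, B.snd_b]
    have t0 := test 0
    have t1 := test 1
    simp only [B.fst_a, B.fst_b, B.snd_a, B.snd_b, r0a, r1a, r0b, r1b, map_one, map_zero] at t0 t1
    constructor
    · linear_combination -t1 - g S.b * hw
    · linear_combination t0 - g S.a * hw
  · intro hm k l hkl
    obtain ⟨g₁, w₁, h₁, e₁, k₁, k₂⟩ := (B.mem_graph_HKrein_iff H hs).1 hkl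
    obtain ⟨g₂, w₂, h₂, e₂, k₃, k₄⟩ := (B.mem_graph_HKrein_iff H hs).1 hm
    rw [inner_sub_inner h₁ e₁ h₂ e₂, k₁, k₂, k₃, k₄]
    simp only [map_add, map_mul, r0a, r1a, r0b, r1b]
    linear_combination (conj (g₁ S.b) * g₂ S.a - conj (g₁ S.a) * g₂ S.b) * hw

lemma exists_basis_ker (B : S.IsBoundaryBasis 0 u v) (H : S.IsFundamentalSystem 0 c c' s s')
    (hs : s S.b ≠ 0) : ∃ e : Module.Basis (Fin 2) ℂ (operatorKer S.Hmin.adjoint),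
      ∀ j, ((e j : S.L2) : ℝ → ℂ) =ᵐ[S.weight] u j := by
  choose U hU using fun j => S.exists_L2 (B.solvesWith j).continuousOn
  have hmem : ∀ j, U j ∈ operatorKer S.Hmin.adjoint := fun j =>
    mem_operatorKer_adjoint_iff.2 ⟨_, _, B.solvesWith_zero j, hU j⟩
  let b : Fin 2 → operatorKer S.Hmin.adjoint := fun j => ⟨U j, hmem j⟩
  have hcomb : ∀ α β : ℂ, ((α • U 0 + β • U 1 : S.L2) : ℝ → ℂ) =ᵐ[S.weight]
      fun x => α * u 0 x + β * u 1 x := by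
    intro α β
    filter_upwards [Lp.coeFn_add (α • U 0) (β • U 1), Lp.coeFn_smul α (U 0),
      Lp.coeFn_smul β (U 1), hU 0, hU 1] with x x1 x2 x3 x4 x5
    rw [x1, Pi.add_apply, x2, x3, Pi.smul_apply, Pi.smul_apply, x4, x5, smul_eq_mul, smul_eq_mul]
  have hli : LinearIndependent ℂ b := by
    have hb : b = ![b 0, b 1] := by
      funext j; fin_cases j <;> rfl
    rw [hb, LinearIndependent.pair_iff]
    intro α β h0
    have h1 : α • U 0 + β • U 1 = 0 := congrArg Subtype.val h0
    have h2 := hcomb α β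
    rw [h1] at h2
    have h3 : EqOn (fun _ => 0) (fun x => α * u 0 x + β * u 1 x) (Icc S.a S.b) :=
      S.eqOn_of_ae_weight continuousOn_const
        (((B.solvesWith 0).const_mul α).add ((B.solvesWith 1).const_mul β)).continuousOn
        ((Lp.coeFn_zero ℂ 2 S.weight).symm.trans h2)
    have ha := h3 S.left_mem
    have hb := h3 S.right_mem
    simp only [B.fst_a, B.fst_b, B.snd_a, B.snd_b] at ha hb
    exact ⟨by linear_combination -hb, by linear_combination -ha⟩
  refine ⟨Module.Basis.mk hli fun n _ => ?_, fun j => ?_⟩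
  · obtain ⟨g, w, hg, e⟩ := mem_operatorKer_adjoint_iff.1 n.2
    have : n = g S.b • b 0 + g S.a • b 1 := by
      apply Subtype.ext
      apply Lp.ext
      filter_upwards [e, hcomb (g S.b) (g S.a), S.ae_weight_mem] with x x1 x2 hx
      refine (x1.trans ?_).trans x2.symm
      exact (B.eq_of_solvesWith H hs (g := g) (w := w) (by simpa using hg)
        (Ioo_subset_Icc_self hx)).1
    rw [this]
    exact Submodule.add_mem _ (Submodule.smul_mem _ _ (Submodule.subset_span ⟨0, rfl⟩))
      (Submodule.smul_mem _ _ (Submodule.subset_span ⟨1, rfl⟩))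
  · rw [Module.Basis.mk_apply]
    exact hU j

/-- The entries are real, and the determinant reduces to `-u₂^{[1]}(b) / u₁^{[1]}(a)`, which is `1`
by the Wronskian relation. -/
lemma exists_specialLinearGroup (B : S.IsBoundaryBasis 0 u v)
    (H : S.IsFundamentalSystem 0 c c' s s') (hs : s S.b ≠ 0) :
    ∃ F : Matrix.SpecialLinearGroup (Fin 2) ℝ,
      F.1.map (fun t : ℝ => (t : ℂ)) = S.kreinMatrix v := by
  have hr : ∀ j x, x ∈ Icc S.a S.b → ((v j x).re : ℂ) = v j x := fun j x hx =>
    Complex.conj_eq_iff_re.1 (B.conj_eqOn (by rwa [map_zero]) H hs j hx).2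
  have h0 : (v 0 S.a).re ≠ 0 := fun h0 => B.quasi_a_ne_zero H (by
    rw [← hr 0 _ S.left_mem, h0, Complex.ofReal_zero])
  have hw : (v 1 S.b).re = -(v 0 S.a).re := by rw [B.wronskian, Complex.neg_re]
  refine ⟨⟨(1 / (v 0 S.a).re) • !![-(v 1 S.a).re, 1;
    (v 0 S.a).re * (v 1 S.b).re - (v 0 S.b).re * (v 1 S.a).re, (v 0 S.b).re], ?_⟩, ?_⟩
  · rw [Matrix.det_fin_two]
    simp [hw]
    field_simp
    ring
  · ext i j
    fin_cases i <;> fin_cases j <;>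
      simp [kreinMatrix, hr 0 _ S.left_mem, hr 1 _ S.left_mem, hr 0 _ S.right_mem,
        hr 1 _ S.right_mem]

/-- The entries of a matrix with the complexification `F_K`. -/
lemma entries_of_map_eq {F : Matrix.SpecialLinearGroup (Fin 2) ℝ}
    (hF : F.1.map (fun t : ℝ => (t : ℂ)) = S.kreinMatrix v) :
    (F.1 0 0 : ℂ) = 1 / v 0 S.a * -v 1 S.a ∧ (F.1 0 1 : ℂ) = 1 / v 0 S.a ∧
    (F.1 1 0 : ℂ) = 1 / v 0 S.a * (v 0 S.a * v 1 S.b - v 0 S.b * v 1 S.a) ∧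
    (F.1 1 1 : ℂ) = 1 / v 0 S.a * v 0 S.b := by
  have h := fun i j => congrFun (congrFun hF i) j
  refine ⟨(h 0 0).trans ?_, (h 0 1).trans ?_, (h 1 0).trans ?_, (h 1 1).trans ?_⟩ <;>
    simp [kreinMatrix]

/-- Since `u₁^{[1]}(a) ≠ 0`, the first Krein condition can be solved for `g(b)`; substituting this
in the second gives the second row of `F_K`. -/
lemma HKrein_eq_HCoupled (B : S.IsBoundaryBasis 0 u v) (H : S.IsFundamentalSystem 0 c c' s s')
    (hs : s S.b ≠ 0) {F : Matrix.SpecialLinearGroup (Fin 2) ℝ}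
    (hF : F.1.map (fun t : ℝ => (t : ℂ)) = S.kreinMatrix v) : S.HKrein = S.HCoupled F 0 := by
  apply LinearPMap.eq_of_eq_graph
  ext ⟨f, h⟩
  rw [B.mem_graph_HKrein_iff H hs, HCoupled, graph_mem_iff]
  refine exists_congr fun g => exists_congr fun w => and_congr_right fun _ =>
    and_congr_right fun _ => ?_
  have h0 := B.quasi_a_ne_zero H
  obtain ⟨f1, f2, f3, f4⟩ := entries_of_map_eq hF
  have e : S.boundaryData g w ∈ coupledData F 0 ↔
      g S.b = F.1 0 0 * g S.a + F.1 0 1 * w S.a ∧ w S.b = F.1 1 0 * g S.a + F.1 1 1 * w S.a := by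
    change ![g S.b, w S.b] = Complex.exp (Complex.I * (0 : ℝ)) •
      Matrix.mulVec (F.1.map (fun t : ℝ => (t : ℂ))) ![g S.a, w S.a] ↔ _
    rw [Complex.ofReal_zero, mul_zero, Complex.exp_zero, one_smul, funext_iff, Fin.forall_fin_two]
    simp [Matrix.mulVec, dotProduct, Fin.sum_univ_two]
  rw [e, f1, f2, f3, f4, KreinCondition]
  constructor
  · rintro ⟨e1, e2⟩
    rw [e1, e2]
    constructor <;> field_simp <;> ring
  · rintro ⟨e1, e2⟩
    have e3 : w S.a = g S.b * v 0 S.a + g S.a * v 1 S.a := by rw [e1]; field_simp; ring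
    refine ⟨e3, ?_⟩
    rw [e2, e3]
    field_simp
    ring

/-! ## The resolvent formula -/

lemma resolventMatrix_eq (B : S.IsBoundaryBasis 0 u v) (H : S.IsFundamentalSystem 0 c c' s s')
    {F : Matrix.SpecialLinearGroup (Fin 2) ℝ}
    (hF : F.1.map (fun t : ℝ => (t : ℂ)) = S.kreinMatrix v) :
    S.resolventMatrix F 0 y = S.kreinResolventMatrix v y := by
  have h0 := B.quasi_a_ne_zero H
  obtain ⟨f1, f2, -, f4⟩ := entries_of_map_eq hF
  rw [resolventMatrix, kreinResolventMatrix, f1, f2, f4]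
  simp only [Complex.ofReal_zero, mul_zero, neg_zero, Complex.exp_zero]
  congr 1
  field_simp

/-- A null vector `d` of the matrix makes `d₀ u₁(z, ·) + d₁ u₂(z, ·)` satisfy the Krein condition.
It would be in the kernel of `H_K - z`, so it is zero, and its boundary values are the entries of
`d`. -/
lemma isUnit_det_kreinResolventMatrix (B : S.IsBoundaryBasis 0 u v)
    (H : S.IsFundamentalSystem 0 c c' s s') (hs : s S.b ≠ 0) (Bz : S.IsBoundaryBasis z y w)
    {R : S.L2 →L[ℂ] S.L2} (hR : IsResolventAt S.HKrein z R) :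
    IsUnit (S.kreinResolventMatrix v w).det := by
  rw [isUnit_iff_ne_zero]
  intro hdet
  obtain ⟨d, hd, h0⟩ := Matrix.exists_mulVec_eq_zero_iff.2 hdet
  have r0 := congrFun h0 0
  have r1 := congrFun h0 1
  simp only [kreinResolventMatrix, Matrix.mulVec, dotProduct, Fin.sum_univ_two, Matrix.of_apply,
    Matrix.cons_val_zero, Matrix.cons_val_one, Pi.zero_apply] at r0 r1
  obtain ⟨N, eN⟩ := Bz.exists_L2_combination (d 0) (d 1)
  have hw := B.wronskian
  have hmem : (N, z • N) ∈ S.HKrein.graph := by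
    refine (B.mem_graph_HKrein_iff H hs).2 ⟨_, _, (((Bz.solvesWith 0).const_mul (d 0)).add
      ((Bz.solvesWith 1).const_mul (d 1))).congr (fun _ _ => rfl) (fun _ _ => rfl) ?_, eN, ?_, ?_⟩
    · filter_upwards [Lp.coeFn_smul z N, eN] with x x1 x2
      rw [x1, Pi.smul_apply, x2, smul_eq_mul]
      ring
    · simp only [Bz.fst_a, Bz.fst_b, Bz.snd_a, Bz.snd_b]
      linear_combination r1
    · simp only [Bz.fst_a, Bz.fst_b, Bz.snd_a, Bz.snd_b]
      linear_combination -r0 - d 1 * hw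
  have hN := (isResolventAt_iff.1 hR).2 _ _ hmem
  rw [sub_self, map_zero] at hN
  have h3 : EqOn (fun _ => 0) (fun x => d 0 * y 0 x + d 1 * y 1 x) (Icc S.a S.b) :=
    S.eqOn_of_ae_weight continuousOn_const
      (((Bz.solvesWith 0).const_mul (d 0)).add ((Bz.solvesWith 1).const_mul (d 1))).continuousOn
      ((Lp.coeFn_zero ℂ 2 S.weight).symm.trans (hN ▸ eN))
  have ha := h3 S.left_mem
  have hb := h3 S.right_mem
  simp only [Bz.fst_a, Bz.fst_b, Bz.snd_a, Bz.snd_b] at ha hb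
  apply hd
  funext j
  fin_cases j
  · simpa using hb.symm
  · simpa using ha.symm

/-- The pairing of a solution of `τ u = z u` with the right-hand side of a Dirichlet problem. -/
lemma integral_mul_eq (Bz : S.IsBoundaryBasis z y w) {g x : ℝ → ℂ} {f : S.L2}
    (hg : S.SolvesWith g x fun t => z * g t + (f : ℝ → ℂ) t) (ga : g S.a = 0) (gb : g S.b = 0)
    (k : Fin 2) : ∫ t, y k t * (f : ℝ → ℂ) t ∂S.weight = x S.a * y k S.a - x S.b * y k S.b := by
  have L := (hg.lagrange (Bz.solvesWith k)).integral_eq S.hab.le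
  rw [ga, gb] at L
  rw [S.integral_weight]
  have e : (fun t => (S.r t : ℂ) * (y k t * (f : ℝ → ℂ) t)) =
      fun t => (S.r t : ℂ) * ((z * g t + (f : ℝ → ℂ) t) * y k t - g t * (z * y k t)) := by
    funext t; ring
  rw [e, L]
  ring

/-- Both resolvents solve `τ g = z g + f`, so they differ by a combination of `u₁(z, ·)`, `u₂(z,
·)`. By `integral_mul_eq` the pairings with `f` are `-x(b)` and `x(a)`, where `x` is the
quasi-derivative of the Dirichlet solution. The Krein condition for the corrected function is then
exactly `Q d = m`. -/
lemma resolvent_formula (B : S.IsBoundaryBasis 0 u v) (H : S.IsFundamentalSystem 0 c c' s s')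
    (hs : s S.b ≠ 0) (Bz : S.IsBoundaryBasis z y w)
    {RK RD : S.L2 →L[ℂ] S.L2} (hK : IsResolventAt S.HKrein z RK)
    (hD : IsResolventAt S.HDirichlet z RD) (f : S.L2) :
    (RK f : ℝ → ℂ) =ᵐ[S.weight] fun x => (RD f : ℝ → ℂ) x -
      ∑ j : Fin 2, ∑ k : Fin 2, (S.kreinResolventMatrix v w)⁻¹ j k *
        (∫ t, y k t * (f : ℝ → ℂ) t ∂S.weight) * y j x := by
  obtain ⟨g, x, hg, eg, ga, gb⟩ := mem_graph_HDirichlet_iff.1 ((isResolventAt_iff.1 hD).1 f)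
  have hg' : S.SolvesWith g x fun t => z * g t + (f : ℝ → ℂ) t :=
    hg.congr (fun _ _ => rfl) (fun _ _ => rfl) (graph_add_smul_ae eg z).symm
  set Q := S.kreinResolventMatrix v w with hQ
  set m : Fin 2 → ℂ := fun k => ∫ t, y k t * (f : ℝ → ℂ) t ∂S.weight with hm
  have hdet := B.isUnit_det_kreinResolventMatrix H hs Bz hK
  set d := Q⁻¹.mulVec m with hd
  have hQd : Q.mulVec d = m := by
    rw [hd, Matrix.mulVec_mulVec, Matrix.mul_nonsing_inv _ hdet, Matrix.one_mulVec]
  have r0 := congrFun hQd 0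
  have r1 := congrFun hQd 1
  have m0 : m 0 = -x S.b := by
    simp only [hm, Bz.integral_mul_eq hg' ga gb, Bz.fst_a, Bz.fst_b]; ring
  have m1 : m 1 = x S.a := by
    simp only [hm, Bz.integral_mul_eq hg' ga gb, Bz.snd_a, Bz.snd_b]; ring
  rw [m0] at r0
  rw [m1] at r1
  simp only [hQ, kreinResolventMatrix, Matrix.mulVec, dotProduct, Fin.sum_univ_two,
    Matrix.of_apply, Matrix.cons_val_zero, Matrix.cons_val_one] at r0 r1
  have hw := B.wronskian
  have hsol := hg'.sub (((Bz.solvesWith 0).const_mul (d 0)).add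
    ((Bz.solvesWith 1).const_mul (d 1)))
  obtain ⟨G, eG⟩ := S.exists_L2 hsol.continuousOn
  have hmem : (G, f + z • G) ∈ S.HKrein.graph := by
    refine (B.mem_graph_HKrein_iff H hs).2 ⟨_, _, hsol.congr (fun _ _ => rfl) (fun _ _ => rfl)
      ((graph_add_smul_ae eG z).trans (Filter.Eventually.of_forall fun t => ?_)), eG, ?_, ?_⟩
    · simp only; ring
    · simp only [Bz.fst_a, Bz.fst_b, Bz.snd_a, Bz.snd_b, ga, gb]
      linear_combination -r1
    · simp only [Bz.fst_a, Bz.fst_b, Bz.snd_a, Bz.snd_b, ga, gb]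
      linear_combination r0 + d 1 * hw
  have hRG := (isResolventAt_iff.1 hK).2 _ _ hmem
  rw [add_sub_cancel_right] at hRG
  rw [hRG]
  filter_upwards [eG, eg] with t t1 t2
  rw [t1, t2]
  simp only [hd, Matrix.mulVec, dotProduct, Fin.sum_univ_two]
  ring

end IsBoundaryBasis

end SturmLiouville

namespace SturmLiouville

variable {S : SturmLiouville}

/-! ## The case `q = 0` -/

lemma intervalIntegrable_inv_p (S : SturmLiouville) :
    IntervalIntegrable (fun x => 1 / S.p x) volume S.a S.b := by
  rw [intervalIntegrable_iff_integrableOn_Ioo_of_le S.hab.le]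
  exact S.p_inv_integrable

lemma inv_p_nonneg_ae (S : SturmLiouville) :
    ∀ᵐ x ∂(volume.restrict (Ioo S.a S.b)), 0 ≤ 1 / S.p x :=
  S.p_pos.mono fun _ hx => (one_div_pos.2 hx).le

lemma pInt_b_pos (S : SturmLiouville) : 0 < S.pInt S.b := by
  rw [pInt, intervalIntegral.integral_of_le S.hab.le, ← restrict_Ioo_eq_restrict_Ioc,
    integral_pos_iff_support_of_nonneg_ae S.inv_p_nonneg_ae S.p_inv_integrable]
  rw [pos_iff_ne_zero]
  intro h0
  have h1 : ∀ᵐ x ∂(volume.restrict (Ioo S.a S.b)), False := by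
    have h2 : ∀ᵐ x ∂(volume.restrict (Ioo S.a S.b)), x ∉ Function.support fun x => 1 / S.p x :=
      measure_eq_zero_iff_ae_notMem.1 h0
    filter_upwards [h2, S.p_pos] with x hx hp
    exact hx (one_div_pos.2 hp).ne'
  rw [Filter.eventually_false_iff_eq_bot, ae_eq_bot, Measure.restrict_eq_zero, Real.volume_Ioo,
    ENNReal.ofReal_eq_zero] at h1
  linarith [S.hab]

/-- Cauchy-Schwarz for the weight `1 / p`. -/
lemma sq_integral_norm_div_le {v : ℝ → ℂ} (hv : ContinuousOn v (Icc S.a S.b)) :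
    (∫ t in S.a..S.b, 1 / S.p t * ‖v t‖) ^ 2 ≤
      S.pInt S.b * ∫ t in S.a..S.b, 1 / S.p t * ‖v t‖ ^ 2 := by
  have hI := S.intervalIntegrable_inv_p
  have hv' : ContinuousOn v (uIcc S.a S.b) := by rwa [uIcc_of_le S.hab.le]
  have i1 := hI.mul_continuousOn hv'.norm
  have i2 : IntervalIntegrable (fun x => 1 / S.p x * ‖v x‖ ^ 2) volume S.a S.b :=
    hI.mul_continuousOn (hv'.norm.pow 2)
  have hP := S.pInt_b_pos
  set J := ∫ t in S.a..S.b, 1 / S.p t * ‖v t‖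
  set E := ∫ t in S.a..S.b, 1 / S.p t * ‖v t‖ ^ 2
  have key : ∀ t : ℝ, 0 ≤ E - 2 * t * J + t ^ 2 * S.pInt S.b := by
    intro t
    have : 0 ≤ ∫ x in S.a..S.b, 1 / S.p x * (‖v x‖ - t) ^ 2 := by
      refine intervalIntegral.integral_nonneg_of_ae_restrict S.hab.le ?_
      rw [← restrict_Ioo_eq_restrict_Icc]
      filter_upwards [S.inv_p_nonneg_ae] with x hx
      exact mul_nonneg hx (sq_nonneg _)
    have e : (fun x => 1 / S.p x * (‖v x‖ - t) ^ 2) = fun x =>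
        1 / S.p x * ‖v x‖ ^ 2 - 2 * t * (1 / S.p x * ‖v x‖) + t ^ 2 * (1 / S.p x) := by
      funext x; ring
    rw [e, intervalIntegral.integral_add (i2.sub (i1.const_mul _)) (hI.const_mul _),
      intervalIntegral.integral_sub i2 (i1.const_mul _), intervalIntegral.integral_const_mul,
      intervalIntegral.integral_const_mul] at this
    exact this
  -- The minimizer of the quadratic in `t`.
  have h := key (J / S.pInt S.b)
  have e : E - 2 * (J / S.pInt S.b) * J + (J / S.pInt S.b) ^ 2 * S.pInt S.b =
      E - J ^ 2 / S.pInt S.b := by field_simp; ring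
  rw [e, sub_nonneg, div_le_iff₀ hP] at h
  linarith

/-- A Poincaré inequality: the form is the energy `E = ∫ |v|² / p`, and since `g(a) = 0`,
Cauchy–Schwarz bounds `|g|²` uniformly by `P(b) E`. -/
lemma strictlyPositive_Hmin_of_q_eq_zero
    (hq : ∀ᵐ x ∂(volume.restrict (Ioo S.a S.b)), S.q x = 0) : StrictlyPositive S.Hmin := by
  set W : ℝ := (measureUnivNNReal S.weight : ℝ) ^ (ENNReal.toReal 2)⁻¹
  have W0 : 0 ≤ W := by positivity
  have hP := S.pInt_b_pos
  -- `W ^ 2` is the total mass; adding `1` makes the denominator positive without discussing `W >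
  -- 0`.
  refine ⟨1 / (W ^ 2 * S.pInt S.b + 1), by positivity, fun f => ?_⟩
  obtain ⟨g, v, hg, e, ga, va, gb, vb⟩ := mem_graph_Hmin_iff.1 (S.Hmin.mem_graph f)
  have hv := hg.continuousOn_quasi
  set E := ∫ t in S.a..S.b, 1 / S.p t * ‖v t‖ ^ 2
  have E0 : 0 ≤ E := by
    refine intervalIntegral.integral_nonneg_of_ae_restrict S.hab.le ?_
    rw [← restrict_Ioo_eq_restrict_Icc]
    filter_upwards [S.inv_p_nonneg_ae] with x hx
    exact mul_nonneg hx (sq_nonneg _)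
  have hinner : inner ℂ (f : S.L2) (S.Hmin f) = (E : ℂ) := by
    rw [S.inner_eq e (ae_eq_refl _)]
    -- Integration by parts: with `q = 0`, the integrand is `|v|² / p` minus the derivative of `conj
    -- g * v`, whose boundary terms vanish.
    have L := hg.star_conj.fst.mul S.hab.le hg.snd
    have L' := L.integral_eq S.hab.le
    simp only [ga, gb, map_zero, zero_mul, sub_zero] at L'
    have i1 : IntervalIntegrable (fun t => ((1 / S.p t * ‖v t‖ ^ 2 : ℝ) : ℂ)) volume S.a S.b := by
      have := S.intervalIntegrable_inv_p.mul_continuousOn (g := fun t => ‖v t‖ ^ 2)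
        (by rw [uIcc_of_le S.hab.le]; exact hv.norm.pow 2)
      exact ⟨this.1.ofReal, this.2.ofReal⟩
    have e2 : (fun t => (S.r t : ℂ) * (conj (g t) * (S.Hmin f : ℝ → ℂ) t))
        =ᵐ[volume.restrict (Ioo S.a S.b)] fun t => ((1 / S.p t * ‖v t‖ ^ 2 : ℝ) : ℂ) -
          (((1 / S.p t : ℝ) : ℂ) * conj (v t) * v t + conj (g t) *
            ((S.q t : ℂ) * g t - (S.r t : ℂ) * (S.Hmin f : ℝ → ℂ) t)) := by
      filter_upwards [hq] with t ht
      rw [ht, mul_assoc, mul_comm (conj (v t)), Complex.mul_conj, Complex.normSq_eq_norm_sq]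
      push_cast
      ring
    rw [intervalIntegral_congr_ae_Ioo e2 S.right_mem,
      intervalIntegral.integral_sub i1 L.integrable, L', sub_zero,
      intervalIntegral.integral_ofReal]
  have hbound : ∀ x ∈ Icc S.a S.b, ‖g x‖ ≤ Real.sqrt (S.pInt S.b * E) := by
    intro x hx
    refine le_trans ?_ (Real.abs_le_sqrt (sq_integral_norm_div_le hv))
    refine le_trans ?_ (le_abs_self _)
    have i1 := S.intervalIntegrable_inv_p.mul_continuousOn (g := fun t => ‖v t‖)
      (by rw [uIcc_of_le S.hab.le]; exact hv.norm)
    rw [hg.fst.eq_add x hx, ga, zero_add]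
    calc _ ≤ ∫ t in S.a..x, 1 / S.p t * ‖v t‖ := by
          have hn := intervalIntegral.norm_integral_le_integral_norm (μ := volume)
            (f := fun t => ((1 / S.p t : ℝ) : ℂ) * v t) hx.1
          refine hn.trans_eq (intervalIntegral_congr_ae_Ioo (b := S.b) ?_ hx)
          filter_upwards [S.inv_p_nonneg_ae] with t ht
          rw [norm_mul, Complex.norm_real, Real.norm_of_nonneg ht]
      _ ≤ _ := by
          refine intervalIntegral.integral_mono_interval le_rfl hx.1 hx.2 ?_ i1
          rw [← restrict_Ioo_eq_restrict_Ioc]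
          filter_upwards [S.inv_p_nonneg_ae] with t ht
          exact mul_nonneg ht (norm_nonneg _)
  have hf : ‖(f : S.L2)‖ ≤ W * Real.sqrt (S.pInt S.b * E) := by
    refine Lp.norm_le_of_ae_bound (Real.sqrt_nonneg _) ?_
    filter_upwards [e, S.ae_weight_mem] with x x1 hx
    rw [x1]
    exact hbound x (Ioo_subset_Icc_self hx)
  have hf2 : ‖(f : S.L2)‖ ^ 2 ≤ W ^ 2 * S.pInt S.b * E := by
    calc _ ≤ (W * Real.sqrt (S.pInt S.b * E)) ^ 2 := by gcongr
      _ = _ := by rw [mul_pow, Real.sq_sqrt (by positivity)]; ring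
  rw [hinner, Complex.ofReal_re, one_div, inv_mul_le_iff₀ (by positivity)]
  linarith

lemma isBoundaryBasis_free (hq : ∀ᵐ x ∂(volume.restrict (Ioo S.a S.b)), S.q x = 0) :
    S.IsBoundaryBasis 0 S.freeSol S.freeQuasi := by
  have hP := S.pInt_b_pos.ne'
  have pP : IsPrimitiveOn (fun x => (S.pInt x : ℂ)) (fun x => ((1 / S.p x : ℝ) : ℂ)) S.a S.b := by
    have hi := S.intervalIntegrable_inv_p
    refine (IsPrimitiveOn.intervalIntegral (f := fun x => ((1 / S.p x : ℝ) : ℂ))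
      ⟨hi.1.ofReal, hi.2.ofReal⟩).congr (fun x _ => ?_) (ae_eq_refl _) S.hab.le
    exact intervalIntegral.integral_ofReal.symm
  have ha : S.pInt S.a = 0 := by simp [pInt]
  have hzero : ∀ (g : ℝ → ℂ), (fun _ => (0 : ℂ)) =ᵐ[volume.restrict (Ioo S.a S.b)]
      fun x => (S.q x : ℂ) * g x - (S.r x : ℂ) * (0 * g x) := fun g => by
    filter_upwards [hq] with x hx
    simp [hx]
  refine ⟨Fin.forall_fin_two.2 ⟨isSolution_iff.2 ⟨?_, ?_⟩, isSolution_iff.2 ⟨?_, ?_⟩⟩, ?_, ?_,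
    ?_, ?_⟩
  · refine (pP.const_mul (((S.pInt S.b)⁻¹ : ℝ) : ℂ)).congr (fun x _ => ?_)
      (Filter.Eventually.of_forall fun x => ?_) S.hab.le
    · exact Complex.ofReal_mul _ _
    · exact mul_comm _ _
  · exact (IsPrimitiveOn.const _ _ _).congr (fun _ _ => rfl) (hzero _) S.hab.le
  · refine ((IsPrimitiveOn.const 1 S.a S.b).sub
      (pP.const_mul (((S.pInt S.b)⁻¹ : ℝ) : ℂ))).congr (fun x _ => ?_)
      (Filter.Eventually.of_forall fun x => ?_) S.hab.le
    · simp [freeSol]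
    · simp [freeQuasi, mul_comm]
  · exact (IsPrimitiveOn.const _ _ _).congr (fun _ _ => rfl) (hzero _) S.hab.le
  · simp [freeSol, ha]
  · simp [freeSol, hP]
  · simp [freeSol, ha]
  · simp [freeSol, hP]

lemma kreinMatrix_freeQuasi (S : SturmLiouville) :
    S.kreinMatrix S.freeQuasi = S.freeKreinMatrix.1.map (fun t : ℝ => (t : ℂ)) := by
  have hP : (S.pInt S.b : ℂ) ≠ 0 := by exact_mod_cast S.pInt_b_pos.ne'
  ext i j
  fin_cases i <;> fin_cases j <;> simp [kreinMatrix, freeQuasi, freeKreinMatrix, hP]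

end SturmLiouville

end

/-! ### Assembly of (A) and (B) -/

theorem mainTheorem6 (S : SturmLiouville) :
    (StrictlyPositive S.Hmin →
      -- the direct sum decomposition of the domain, and the extension property
      Dense (S.Hmin.domain : Set S.L2) ∧
      Disjoint S.Hmin.domain (operatorKer S.Hmin.adjoint) ∧
      S.HKrein.domain = S.Hmin.domain ⊔ operatorKer S.Hmin.adjoint ∧
      S.Hmin ≤ S.HKrein ∧ IsSelfAdjoint S.HKrein ∧
      -- the solutions `u₁(z, ·)`, `u₂(z, ·)` exist and are unique, in particular at `z = 0`
      (0 : ℂ) ∈ resolventSetOf S.HDirichlet ∧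
      (∀ z ∈ resolventSetOf S.HDirichlet,
        (∃ u v, S.IsBoundaryBasis z u v) ∧
        ∀ u v u' v', S.IsBoundaryBasis z u v → S.IsBoundaryBasis z u' v' →
          ∀ j, Set.EqOn (u j) (u' j) (Set.Icc S.a S.b) ∧
            Set.EqOn (v j) (v' j) (Set.Icc S.a S.b)) ∧
      -- `u z j` stands for `u_{j+1}(z, ·)`, and `v z j` for its quasi-derivative
      ∀ u v : ℂ → Fin 2 → ℝ → ℂ,
        (∀ z ∈ resolventSetOf S.HDirichlet, S.IsBoundaryBasis z (u z) (v z)) →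
        (∀ j, ∀ x ∈ Set.Icc S.a S.b, (u 0 j x).im = 0 ∧ (v 0 j x).im = 0) ∧
        (∃ e : Module.Basis (Fin 2) ℂ (operatorKer S.Hmin.adjoint),
          ∀ j, ((e j : S.L2) : ℝ → ℂ) =ᵐ[S.weight] u 0 j) ∧
        -- the boundary conditions, first written out, then in terms of the matrix `F_K`
        (∀ (f h : S.L2) (g w : ℝ → ℂ), S.Represents g w f h →
          (f ∈ S.HKrein.domain ↔
            w S.a = g S.b * v 0 0 S.a + g S.a * v 0 1 S.a ∧
            w S.b = g S.b * v 0 0 S.b + g S.a * v 0 1 S.b)) ∧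
        v 0 0 S.a ≠ 0 ∧
        ∃ F : Matrix.SpecialLinearGroup (Fin 2) ℝ,
          F.1.map (fun t : ℝ => (t : ℂ)) = S.kreinMatrix (v 0) ∧
          S.HKrein = S.HCoupled F 0 ∧
          -- the resolvent formula
          ∀ (z : ℂ) (RK RD : S.L2 →L[ℂ] S.L2),
            IsResolventAt S.HKrein z RK → IsResolventAt S.HDirichlet z RD →
            S.resolventMatrix F 0 (v z) =
              !![v 0 0 S.b - v z 0 S.b, -v 0 0 S.a - v z 1 S.b;
                -v 0 0 S.a + v z 0 S.a, -v 0 1 S.a + v z 1 S.a] ∧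
            IsUnit (S.resolventMatrix F 0 (v z)).det ∧
            ∀ f : S.L2, (RK f : ℝ → ℂ) =ᵐ[S.weight] fun x =>
              (RD f : ℝ → ℂ) x - ∑ j : Fin 2, ∑ k : Fin 2,
                (S.resolventMatrix F 0 (v z))⁻¹ j k *
                  (∫ y, conj (u (conj z) k y) * (f : ℝ → ℂ) y ∂S.weight) * u z j x) ∧
    -- the case `q = 0`
    ((∀ᵐ x ∂(volume.restrict (Set.Ioo S.a S.b)), S.q x = 0) →
      StrictlyPositive S.Hmin ∧
      S.IsBoundaryBasis 0 S.freeSol S.freeQuasi ∧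
      (∃ e : Module.Basis (Fin 2) ℂ (operatorKer S.Hmin.adjoint),
        ∀ j, ((e j : S.L2) : ℝ → ℂ) =ᵐ[S.weight] S.freeSol j ∧
          ((e j : S.L2), (0 : S.L2)) ∈ S.Hmin.adjoint.graph ∧
          ((e j : S.L2), (0 : S.L2)) ∈ S.Hmax.graph) ∧
      S.kreinMatrix S.freeQuasi = S.freeKreinMatrix.1.map (fun t : ℝ => (t : ℂ)) ∧
      S.HKrein = S.HCoupled S.freeKreinMatrix 0 ∧
      ∀ (f h : S.L2) (g w : ℝ → ℂ), S.Represents g w f h →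
        (f ∈ S.HKrein.domain ↔
          w S.b = w S.a ∧ w S.a = ((S.pInt S.b)⁻¹ : ℝ) * (g S.b - g S.a))) := by
  have hconj0 : conj (0 : ℂ) = 0 := map_zero _
  obtain ⟨c, c', s, s', H⟩ := S.exists_isFundamentalSystem 0
  refine ⟨fun hpos => ?_, fun hq => ?_⟩
  · have hs := H.sin_b_ne_zero_of_strictlyPositive hpos
    have h0 := H.zero_mem_resolventSetOf hs
    obtain ⟨u₀, v₀, B₀⟩ := H.exists_isBoundaryBasis hs
    refine ⟨S.dense_Hmin, B₀.disjoint_domain_ker H hs, S.domain_HKrein, S.Hmin_le_HKrein,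
      B₀.isSelfAdjoint_HKrein H hs, h0, ?_, ?_⟩
    · rintro z ⟨R, hR⟩
      obtain ⟨d, d', t, t', K⟩ := S.exists_isFundamentalSystem z
      have ht := K.sin_b_ne_zero hR
      exact ⟨K.exists_isBoundaryBasis ht, fun u v u' v' B B' j => B.eqOn B' K ht j⟩
    · intro u v huv
      have B := huv 0 h0
      obtain ⟨F, hF⟩ := B.exists_specialLinearGroup H hs
      refine ⟨fun j x hx => ?_, B.exists_basis_ker H hs, fun f h g w hR => ?_,
        B.quasi_a_ne_zero H, F, hF, B.HKrein_eq_HCoupled H hs hF, ?_⟩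
      · have := B.conj_eqOn (by rwa [hconj0]) H hs j hx
        exact ⟨Complex.conj_eq_iff_im.1 this.1, Complex.conj_eq_iff_im.1 this.2⟩
      · exact B.mem_HKrein_domain_iff H hs hR.solvesWith hR.fst_eq
      · intro z RK RD hK hD
        have hz : z ∈ resolventSetOf S.HDirichlet := ⟨RD, hD⟩
        obtain ⟨d, d', t, t', K⟩ := S.exists_isFundamentalSystem z
        have ht := K.sin_b_ne_zero hD
        have Bz := huv z hz
        have Bz' := huv (conj z) (SturmLiouville.conj_mem_resolventSetOf_HDirichlet hz)
        rw [B.resolventMatrix_eq H hF]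
        refine ⟨rfl, B.isUnit_det_kreinResolventMatrix H hs Bz hK, fun f => ?_⟩
        -- `conj (u_k(conj z, ·)) = u_k(z, ·)` turns the inner products of the resolvent formula
        -- into unconjugated pairings with the solutions at `z`.
        have hint : ∀ k, ∫ y, conj (u (conj z) k y) * (f : ℝ → ℂ) y ∂S.weight =
            ∫ y, u z k y * (f : ℝ → ℂ) y ∂S.weight := fun k =>
          integral_congr_ae (S.ae_weight_mem.mono fun x hx => by
            simp only [(Bz.conj_eqOn Bz' K ht k (Ioo_subset_Icc_self hx)).1])
        simp only [hint]
        exact B.resolvent_formula H hs Bz hK hD f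
  · have hpos := SturmLiouville.strictlyPositive_Hmin_of_q_eq_zero hq
    -- From here the results of (A) apply with the explicit pair `freeSol`, `freeQuasi` as the basis
    -- at `z = 0`.
    have hs := H.sin_b_ne_zero_of_strictlyPositive hpos
    have B := SturmLiouville.isBoundaryBasis_free hq
    refine ⟨hpos, B, ?_, S.kreinMatrix_freeQuasi,
      B.HKrein_eq_HCoupled H hs S.kreinMatrix_freeQuasi.symm, fun f h g w hR => ?_⟩
    · obtain ⟨e, he⟩ := B.exists_basis_ker H hs
      refine ⟨e, fun j => ?_⟩
      have hmem := mem_operatorKer_iff.1 (e j).2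
      exact ⟨he j, hmem, LinearPMap.le_graph_of_le S.adjoint_Hmin.le hmem⟩
    · rw [B.mem_HKrein_domain_iff H hs hR.solvesWith hR.fst_eq, SturmLiouville.KreinCondition]
      simp only [SturmLiouville.freeQuasi, Matrix.cons_val_zero, Matrix.cons_val_one,
        Complex.ofReal_neg]
      constructor
      · rintro ⟨e1, e2⟩
        exact ⟨by rw [e1, e2], by rw [e1]; ring⟩
      · rintro ⟨e1, e2⟩
        exact ⟨by rw [e2]; ring, by rw [e1, e2]; ring⟩
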